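/- Let $n\ge 1$ and let $\mathcal N_0^n=\mathrm{Sym}^+(n,\mathbb R)$ be the manifold of centered normal distributions on $\mathbb R^n$ (an open subset of the space of symmetric matrices, $\Sigma$ standing for the distribution with density $p(x;\Sigma)=((2\pi)^n\det\Sigma)^{-1/2}e^{-\frac12 x^{T}\Sigma^{-1}x}$). Let $g^F$ be the Fisher metric, $g^F_\Sigma(X,Y)=\int_{\mathbb R^n}(X\log p(x;\cdot))(Y\log p(x;\cdot))\,p(x;\Sigma)\,dx$, a smooth Riemannian metric on $\mathcal N_0^n$, let $\nabla^{g^F}$ be its (unique) Levi-Civita connection, and let $G=\mathrm{Isom}(\mathcal N_0^n,g^F)$ be the group of all isometries, with its Lie group (compact-open) topology. A statistical connection on a Riemannian manifold $(M,g)$ is a torsion-free affine connection $\nabla$ such that $\nabla g$ is totally symmetric; it is dually flat if moreover its curvature vanishes. Let $\mathrm{Stat}^G(M,g)$ be the set of $G$-invariant statistical connections and $\mathrm{Stat}^G_{\mathrm{DF}}(M,g)$ the subset of dually flat ones. For $\nabla,\nabla'\in\mathrm{Stat}^G(M,g)$ write $\nabla\sim_{\mathbf{HS}}\nabla'$ if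 there are a Lie group automorphism $\phi$ of $G$ and an isometry $f$ of $(M,g)$ that carries $\nabla$ to $\nabla'$ and satisfies $f(h\cdot x)=\phi(h)\cdot f(x)$ for all $h\in G$, $x\in M$. The $\mathbf{HS}$-moduli spaces $\mathcal M_{\mathbf{HS}}\mathrm{Stat}^G(M,g)$ and $\mathcal M_{\mathbf{HS}}\mathrm{Stat}^G_{\mathrm{DF}}(M,g)$ are the quotients of these two sets by $\sim_{\mathbf{HS}}$. Then $$\mathrm{Stat}^G(\mathcal N_0^n,g^F)=\{\nabla^{g^F}\},\qquad \mathrm{Stat}^G_{\mathrm{DF}}(\mathcal N_0^n,g^F)=\begin{cases}\emptyset&(n\ge2),\\ \{\nabla^{g^F}\}&(n=1),\end{cases}$$ $$\mathcal M_{\mathbf{HS}}\mathrm{Stat}^G(\mathcal N_0^n,g^F)=\{[\nabla^{g^F}]\},\qquad \mathcal M_{\mathbf{HS}}\mathrm{Stat}^G_{\mathrm{DF}}(\mathcal N_0^n,g^F)=\begin{cases}\emptyset&(n\ge2),\\ \{[\nabla^{g^F}]\}&(n=1).\end{cases}$$ -/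

import Mathlib

open MeasureTheory
open scoped Manifold ContDiff Matrix Topology

/-! ## Affine connections and statistical structures on a Riemannian manifold -/

noncomputable section StatisticalManifolds

set_option linter.unusedSectionVars false

variable {E : Type*} [NormedAddCommGroup E] [NormedSpace ℝ E] [FiniteDimensional ℝ E]
  {H : Type*} [TopologicalSpace H] (I : ModelWithCorners ℝ E H)
  (M : Type*) [TopologicalSpace M] [ChartedSpace H M] [IsManifold I ∞ M]

/-- The space `Γ(TM)` of smooth vector fields on `M`. -/
abbrev SmoothVectorField := ContMDiffSection I E ∞ (TangentSpace I : M → Type _)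

/-- The space of smooth Riemannian metrics on `M`. -/
abbrev SmoothRiemannianMetric :=
  Bundle.ContMDiffRiemannianMetric I ∞ E (TangentSpace I : M → Type _)

variable {I M}

/-- The product `f X` of a smooth function and a smooth vector field. -/
def SmoothVectorField.fsmul (f : C^∞⟮I, M; 𝓘(ℝ, ℝ), ℝ⟯) (X : SmoothVectorField I M) :
    SmoothVectorField I M :=
  ⟨fun p => f p • X p, f.contMDiff.smul_section X.contMDiff⟩

/-- The Lie bracket `[X, Y]` of smooth vector fields. -/
def SmoothVectorField.bracket (X Y : SmoothVectorField I M) : SmoothVectorField I M :=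
  ⟨VectorField.mlieBracket I X Y, by
    have : CompleteSpace E := FiniteDimensional.complete ℝ E
    have : IsManifold I (minSmoothness ℝ 2) M := by
      rw [minSmoothness_of_isRCLikeNormedField]
      exact IsManifold.of_le (n := ∞) ENat.LEInfty.out
    have : IsManifold I (minSmoothness ℝ 3) M := by
      rw [minSmoothness_of_isRCLikeNormedField]
      exact IsManifold.of_le (n := ∞) ENat.LEInfty.out
    have : IsManifold I (((⊤ : ℕ∞) : WithTop ℕ∞) + 1) M := by
      exact IsManifold.of_le (n := ∞) (by simp)
    have h := ContDiff.mlieBracket_vectorField (I := I) (m := ⊤) (n := ⊤)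
      (U := X) (V := Y) X.contMDiff Y.contMDiff (by simp)
    exact h⟩

/-- The derivative `(X f)(p)` at `p` of a real function `f` along the vector field `X`. -/
def SmoothVectorField.deriv (X : SmoothVectorField I M) (f : M → ℝ) (p : M) : ℝ :=
  mfderiv I 𝓘(ℝ, ℝ) f p (X p)

variable (I M) in
/-- An affine connection on `M`: an operator `(X, Y) ↦ ∇_X Y` on smooth vector fields that is
`C^∞(M)`-linear in `X`, additive in `Y` and satisfies the Leibniz rule in `Y`. -/
@[ext]
structure AffineConnection where
  /-- `toFun X Y` is `∇_X Y`. -/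
  toFun : SmoothVectorField I M → SmoothVectorField I M → SmoothVectorField I M
  add_left : ∀ X X' Y, toFun (X + X') Y = toFun X Y + toFun X' Y
  smul_left : ∀ f X Y, toFun (SmoothVectorField.fsmul f X) Y =
    SmoothVectorField.fsmul f (toFun X Y)
  add_right : ∀ X Y Y', toFun X (Y + Y') = toFun X Y + toFun X Y'
  leibniz : ∀ (f : C^∞⟮I, M; 𝓘(ℝ, ℝ), ℝ⟯) X Y (p : M),
    toFun X (SmoothVectorField.fsmul f Y) p = f p • toFun X Y p + X.deriv f p • Y p

namespace AffineConnection

/-- `∇_X Y - ∇_Y X = [X, Y]`. -/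
def IsTorsionFree (D : AffineConnection I M) : Prop :=
  ∀ X Y, D.toFun X Y - D.toFun Y X = X.bracket Y

/-- The curvature `R(X, Y) Z = ∇_X ∇_Y Z - ∇_Y ∇_X Z - ∇_[X,Y] Z`. -/
def curvature (D : AffineConnection I M) (X Y Z : SmoothVectorField I M) :
    SmoothVectorField I M :=
  D.toFun X (D.toFun Y Z) - D.toFun Y (D.toFun X Z) - D.toFun (X.bracket Y) Z

/-- The curvature tensor vanishes. -/
def IsFlat (D : AffineConnection I M) : Prop :=
  ∀ X Y Z, D.curvature X Y Z = 0

/-- `(∇_X g)(Y, Z) = X g(Y, Z) - g(∇_X Y, Z) - g(Y, ∇_X Z)`, as a function on `M`. -/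
def nablaMetric (D : AffineConnection I M) (g : SmoothRiemannianMetric I M)
    (X Y Z : SmoothVectorField I M) (p : M) : ℝ :=
  X.deriv (fun q => g.inner q (Y q) (Z q)) p
    - g.inner p (D.toFun X Y p) (Z p) - g.inner p (Y p) (D.toFun X Z p)

/-- `∇` is the Levi-Civita connection of `g`: torsion-free with `∇ g = 0`. -/
def IsLeviCivita (D : AffineConnection I M) (g : SmoothRiemannianMetric I M) : Prop :=
  D.IsTorsionFree ∧ ∀ X Y Z p, D.nablaMetric g X Y Z p = 0

/-- `∇` is a statistical connection on `(M, g)`: torsion-free with `∇ g` totally symmetric. -/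
def IsStatistical (D : AffineConnection I M) (g : SmoothRiemannianMetric I M) : Prop :=
  D.IsTorsionFree ∧ ∀ X Y Z p, D.nablaMetric g X Y Z p = D.nablaMetric g Y X Z p

end AffineConnection

/-! ### Maps, isometries and invariance -/

/-- The vector fields `X` and `X'` are `f`-related: `df_p (X_p) = X'_{f(p)}` for all `p`.
For a diffeomorphism `f` this says `X' = f_* X`. -/
def VectorFieldRelated (f : M → M) (X X' : SmoothVectorField I M) : Prop :=
  ∀ p, mfderiv I I f p (X p) = X' (f p)

/-- The map `f` (in practice a diffeomorphism of `M`) carries `∇` to `∇'`, that is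
`f_* (∇_X Y) = ∇'_{f_* X} (f_* Y)`. -/
def IsAffineMap (f : M → M) (D D' : AffineConnection I M) : Prop :=
  ∀ X X' Y Y', VectorFieldRelated f X X' → VectorFieldRelated f Y Y' →
    VectorFieldRelated f (D.toFun X Y) (D'.toFun X' Y')

/-- `f^* g = g`. -/
def PreservesMetric (g : SmoothRiemannianMetric I M) (f : M → M) : Prop :=
  ∀ p (v w : TangentSpace I p),
    g.inner (f p) (mfderiv I I f p v) (mfderiv I I f p w) = g.inner p v w

lemma mfderiv_diffeo_symm (f : M ≃ₘ⟮I, I⟯ M) (p : M) (v : TangentSpace I (f p)) :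
    mfderiv I I f p (mfderiv I I f.symm (f p) v) = v := by
  have hf : MDifferentiableAt I I f (f.symm (f p)) := f.contMDiff.mdifferentiableAt (by simp)
  have hs : MDifferentiableAt I I f.symm (f p) := f.symm.contMDiff.mdifferentiableAt (by simp)
  have h := mfderiv_comp (f p) hf hs
  have e : (f ∘ f.symm : M → M) = id := by ext x; simp
  rw [e, mfderiv_id] at h
  have key : ∀ (r : M), r = p → ∀ a : E,
      (mfderiv I I f p a : E) = mfderiv I I f r a := by rintro _ rfl _; rfl
  exact (key _ (f.symm_apply_apply p) _).trans (congrArg (fun L => L v) h).symm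

lemma mfderiv_symm_diffeo (f : M ≃ₘ⟮I, I⟯ M) (p : M) (v : TangentSpace I p) :
    mfderiv I I f.symm (f p) (mfderiv I I f p v) = v := by
  have hf : MDifferentiableAt I I f p := f.contMDiff.mdifferentiableAt (by simp)
  have hs : MDifferentiableAt I I f.symm (f p) := f.symm.contMDiff.mdifferentiableAt (by simp)
  have h := mfderiv_comp p hs hf
  have e : (f.symm ∘ f : M → M) = id := by ext x; simp
  rw [e, mfderiv_id] at h
  exact (congrArg (fun L => L v) h).symm

lemma mfderiv_diffeo_comp (f₂ f₁ : M ≃ₘ⟮I, I⟯ M) (p : M) (v : TangentSpace I p) :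
    mfderiv I I (f₁.trans f₂) p v = mfderiv I I f₂ (f₁ p) (mfderiv I I f₁ p v) := by
  have h := mfderiv_comp p (f₂.contMDiff.mdifferentiableAt (n := ∞) (by simp))
    (f₁.contMDiff.mdifferentiableAt (n := ∞) (x := p) (by simp))
  exact congrArg (fun L => L v) h

lemma PreservesMetric.comp {g : SmoothRiemannianMetric I M} {f₂ f₁ : M ≃ₘ⟮I, I⟯ M}
    (h₂ : PreservesMetric g f₂) (h₁ : PreservesMetric g f₁) :
    PreservesMetric g (f₁.trans f₂) := by
  intro p v w
  rw [mfderiv_diffeo_comp, mfderiv_diffeo_comp]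
  exact (h₂ (f₁ p) _ _).trans (h₁ p v w)

lemma PreservesMetric.refl (g : SmoothRiemannianMetric I M) :
    PreservesMetric g (Diffeomorph.refl I M ∞) := by
  intro p v w
  have : mfderiv I I (Diffeomorph.refl I M ∞) p = ContinuousLinearMap.id ℝ _ := mfderiv_id
  rw [this]; rfl

lemma PreservesMetric.symm {g : SmoothRiemannianMetric I M} {f : M ≃ₘ⟮I, I⟯ M}
    (h : PreservesMetric g f) : PreservesMetric g f.symm := by
  intro q v w
  obtain ⟨p, rfl⟩ : ∃ p, f p = q := f.surjective q
  have h' := h p (mfderiv I I f.symm (f p) v) (mfderiv I I f.symm (f p) w)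
  rw [mfderiv_diffeo_symm, mfderiv_diffeo_symm] at h'
  rw [h']
  have : ∀ (r : M), r = p → ∀ a b : E, g.inner r a b = g.inner p a b := by
    rintro _ rfl _ _; rfl
  exact this _ (f.symm_apply_apply p) _ _

lemma VectorFieldRelated.symm_iff (f : M ≃ₘ⟮I, I⟯ M) (X X' : SmoothVectorField I M) :
    VectorFieldRelated f.symm X' X ↔ VectorFieldRelated f X X' := by
  constructor
  · intro h p
    have h1 := h (f p)
    have : ∀ (r : M), r = p → (X r : E) = X p := by rintro _ rfl; rfl
    have h2 : (mfderiv I I f.symm (f p) (X' (f p)) : E) = X p :=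
      h1.trans (this _ (f.symm_apply_apply p))
    rw [← mfderiv_diffeo_symm f p (X' (f p))]
    exact congrArg (mfderiv I I f p) h2.symm
  · intro h q
    obtain ⟨p, rfl⟩ : ∃ p, f p = q := f.surjective q
    rw [← h p, mfderiv_symm_diffeo]
    have : ∀ (r : M), r = p → (X p : E) = X r := by rintro _ rfl; rfl
    exact this _ (f.symm_apply_apply p)

lemma IsAffineMap.symm {f : M ≃ₘ⟮I, I⟯ M} {D D' : AffineConnection I M}
    (h : IsAffineMap f D D') : IsAffineMap f.symm D' D := by
  intro X X' Y Y' hX hY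
  rw [VectorFieldRelated.symm_iff] at hX hY ⊢
  exact h _ _ _ _ hX hY

/-- The push-forward `f_* X` of a vector field along a diffeomorphism. -/
def SmoothVectorField.push (f : M ≃ₘ⟮I, I⟯ M) (X : SmoothVectorField I M) :
    SmoothVectorField I M :=
  ⟨fun q => (mfderiv I I f (f.symm q) (X (f.symm q)) : E), by
    have h1 : ContMDiff I.tangent I.tangent ∞ (tangentMap I I f) :=
      f.contMDiff.contMDiff_tangentMap (by simp)
    have h2 := h1.comp (X.contMDiff.comp f.symm.contMDiff)
    convert h2 using 1
    funext q
    have : ∀ (r : M), r = q → ∀ a : E,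
        (⟨q, a⟩ : TangentBundle I M) = ⟨r, a⟩ := by rintro _ rfl _; rfl
    exact this _ (f.apply_symm_apply q) _⟩

lemma SmoothVectorField.related_push (f : M ≃ₘ⟮I, I⟯ M) (X : SmoothVectorField I M) :
    VectorFieldRelated f X (X.push f) := by
  intro p
  have : ∀ (r : M), p = r → (mfderiv I I f p (X p) : E) = mfderiv I I f r (X r) := by
    rintro _ rfl; rfl
  exact this _ (f.symm_apply_apply p).symm

lemma IsAffineMap.trans {f₁ f₂ : M ≃ₘ⟮I, I⟯ M} {D D' D'' : AffineConnection I M}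
    (h₁ : IsAffineMap f₁ D D') (h₂ : IsAffineMap f₂ D' D'') :
    IsAffineMap (f₁.trans f₂) D D'' := by
  have key : ∀ {X X''}, VectorFieldRelated (f₁.trans f₂) X X'' →
      VectorFieldRelated f₂ (X.push f₁) X'' := by
    intro X X'' h q
    obtain ⟨p, rfl⟩ : ∃ p, f₁ p = q := f₁.surjective q
    have := h p
    rw [mfderiv_diffeo_comp, X.related_push f₁ p] at this
    exact this
  intro X X'' Y Y'' hX hY p
  rw [mfderiv_diffeo_comp,
    h₁ _ _ _ _ (X.related_push f₁) (Y.related_push f₁) p]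
  exact h₂ _ _ _ _ (key hX) (key hY) (f₁ p)

lemma IsAffineMap.refl (D : AffineConnection I M) :
    IsAffineMap (Diffeomorph.refl I M ∞) D D := by
  have e : ∀ p, mfderiv I I (Diffeomorph.refl I M ∞) p = ContinuousLinearMap.id ℝ _ :=
    fun p => mfderiv_id
  have key : ∀ {X X' : SmoothVectorField I M},
      VectorFieldRelated (Diffeomorph.refl I M ∞) X X' → X = X' := by
    intro X X' h
    ext p
    have := h p
    rw [e] at this
    exact this
  intro X X' Y Y' hX hY p
  obtain rfl := key hX
  obtain rfl := key hY
  rw [e]; rfl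

/-! ### The isometry group -/

/-- The isometry group `Isom(M, g)`: all diffeomorphisms of `M` that preserve `g`. -/
def RiemannianIsom (g : SmoothRiemannianMetric I M) : Type _ :=
  {f : M ≃ₘ⟮I, I⟯ M // PreservesMetric g f}

namespace RiemannianIsom

variable {g : SmoothRiemannianMetric I M}

instance : Group (RiemannianIsom g) where
  mul a b := ⟨b.1.trans a.1, a.2.comp b.2⟩
  one := ⟨Diffeomorph.refl I M ∞, PreservesMetric.refl g⟩
  inv a := ⟨a.1.symm, a.2.symm⟩
  mul_assoc _ _ _ := Subtype.ext (Diffeomorph.ext fun _ => rfl)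
  one_mul _ := Subtype.ext (Diffeomorph.ext fun _ => rfl)
  mul_one _ := Subtype.ext (Diffeomorph.ext fun _ => rfl)
  inv_mul_cancel a := Subtype.ext (Diffeomorph.ext fun x => a.1.symm_apply_apply x)

/-- The tautological action of `Isom(M, g)` on `M`. -/
instance : MulAction (RiemannianIsom g) M where
  smul a x := a.1 x
  one_smul _ := rfl
  mul_smul _ _ _ := rfl

/-- The isometry group carries the compact-open topology, i.e. its Lie group topology. -/
instance : TopologicalSpace (RiemannianIsom g) :=
  TopologicalSpace.induced (fun a => (⟨a.1, a.1.continuous⟩ : C(M, M))) inferInstance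

end RiemannianIsom

/-! ### Invariant statistical connections and their moduli spaces -/

section Invariant

variable (g : SmoothRiemannianMetric I M)
  (G : Type*) [Group G] [TopologicalSpace G] [MulAction G M]

/-- `Stat^G(M, g)`: the `G`-invariant statistical connections on `(M, g)`. -/
def invariantStat : Set (AffineConnection I M) :=
  {D | D.IsStatistical g ∧ ∀ h : G, IsAffineMap (fun p : M => h • p) D D}

/-- `Stat^G_DF(M, g)`: the `G`-invariant dually flat statistical connections on `(M, g)`. -/
def invariantStatDF : Set (AffineConnection I M) :=
  {D | D ∈ invariantStat g G ∧ D.IsFlat}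

/-- `(M, g, ∇, G)` and `(M, g, ∇', G)` are isomorphic homogeneous statistical manifolds:
there are an automorphism `φ` of the Lie group `G` and an isometry `f` of `(M, g)` carrying
`∇` to `∇'` with `f (h x) = φ(h) f(x)`. An isomorphism of Lie groups is an isomorphism of
groups that is a homeomorphism (continuous homomorphisms of Lie groups are smooth). -/
def HSEquivalent (D D' : AffineConnection I M) : Prop :=
  ∃ (φ : G ≃ₜ* G) (f : M ≃ₘ⟮I, I⟯ M), PreservesMetric g f ∧ IsAffineMap f D D' ∧
    ∀ (h : G) (x : M), f (h • x) = φ h • f x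

/-- The equivalence relation `∼_HS`. -/
def hsSetoid : Setoid (AffineConnection I M) where
  r := HSEquivalent g G
  iseqv :=
    { refl := fun D => ⟨ContinuousMulEquiv.refl G, Diffeomorph.refl I M ∞,
        PreservesMetric.refl g, IsAffineMap.refl D, fun _ _ => rfl⟩
      symm := by
        rintro D D' ⟨φ, f, hf, hD, he⟩
        refine ⟨φ.symm, f.symm, hf.symm, hD.symm, fun h x => ?_⟩
        apply f.injective
        change f (f.symm (h • x)) = f (φ.symm h • f.symm x)
        rw [he]
        simp
      trans := by
        rintro D D' D'' ⟨φ, f, hf, hD, he⟩ ⟨φ', f', hf', hD', he'⟩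
        refine ⟨φ.trans φ', f.trans f', hf'.comp hf, hD.trans hD', fun h x => ?_⟩
        change f' (f (h • x)) = φ' (φ h) • f' (f x)
        rw [he, he'] }

/-- The quotient of a set `S` of connections by `∼_HS`. For `S = Stat^G(M, g)` and
`S = Stat^G_DF(M, g)` these are the `HS`-moduli spaces. -/
def HSModuli (S : Set (AffineConnection I M)) : Type _ :=
  Quotient ((hsSetoid g G).comap (Subtype.val : S → AffineConnection I M))

/-- The class `[∇]` in the moduli space of an element `∇` of `S`. -/
def HSModuli.mk {S : Set (AffineConnection I M)} (D : AffineConnection I M) (hD : D ∈ S) :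
    HSModuli g G S :=
  Quotient.mk _ ⟨D, hD⟩

end Invariant

end StatisticalManifolds

/-! ## The space of centered Gaussian distributions and the Fisher metric -/

noncomputable section CenteredGaussians

/-- The symmetric matrices as a linear subspace of all real `n × n` matrices. -/
def symSubmodule (n : ℕ) : Submodule ℝ (Matrix (Fin n) (Fin n) ℝ) where
  carrier := {A | A.IsSymm}
  add_mem' := fun ha hb => ha.add hb
  zero_mem' := Matrix.isSymm_zero
  smul_mem' := fun c _ ha => ha.smul c

/-- The vector space `Sym(n, ℝ)` of symmetric matrices. -/
def SymMatrix (n : ℕ) : Type := symSubmodule n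

namespace SymMatrix

variable {n : ℕ}

-- A norm inducing the usual topology; it only serves to speak of smoothness.
attribute [local instance] Matrix.normedAddCommGroup Matrix.normedSpace in
instance : NormedAddCommGroup (SymMatrix n) :=
  inferInstanceAs (NormedAddCommGroup (symSubmodule n))

attribute [local instance] Matrix.normedAddCommGroup Matrix.normedSpace in
instance : NormedSpace ℝ (SymMatrix n) :=
  inferInstanceAs (NormedSpace ℝ (symSubmodule n))

instance : FiniteDimensional ℝ (SymMatrix n) :=
  inferInstanceAs (FiniteDimensional ℝ (symSubmodule n))

/-- The underlying matrix, as a linear map. -/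
def mat : SymMatrix n →ₗ[ℝ] Matrix (Fin n) (Fin n) ℝ := (symSubmodule n).subtype

lemma mat_transpose (A : SymMatrix n) : (mat A)ᵀ = mat A :=
  Subtype.property (p := fun A => A ∈ symSubmodule n) A

lemma continuous_mat : Continuous (mat : SymMatrix n → Matrix (Fin n) (Fin n) ℝ) :=
  mat.continuous_of_finiteDimensional

lemma isOpen_posDef : IsOpen {S : SymMatrix n | (mat S).PosDef} := by
  rw [isOpen_iff_mem_nhds]
  intro S hS
  have hc : Continuous fun q : SymMatrix n × (Fin n → ℝ) => q.2 ⬝ᵥ (mat q.1 *ᵥ q.2) :=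
    continuous_snd.dotProduct
      ((continuous_mat.comp continuous_fst).matrix_mulVec continuous_snd)
  have hev : ∀ᶠ T : SymMatrix n in 𝓝 S, ∀ x ∈ Metric.sphere (0 : Fin n → ℝ) 1,
      0 < x ⬝ᵥ (mat T *ᵥ x) := by
    refine (isCompact_sphere (0 : Fin n → ℝ) 1).eventually_forall_of_forall_eventually ?_
    intro x hx
    have hx0 : x ≠ 0 := by
      rintro rfl
      simp at hx
    have h0 := (Matrix.posDef_iff_dotProduct_mulVec.mp hS).2 hx0
    exact hc.continuousAt.eventually (lt_mem_nhds (by simpa using h0))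
  filter_upwards [hev] with T hT
  refine Matrix.posDef_iff_dotProduct_mulVec.mpr ⟨?_, fun x hx => ?_⟩
  · rw [Matrix.IsHermitian, Matrix.conjTranspose_eq_transpose_of_trivial, mat_transpose]
  · have hn : 0 < ‖x‖ := norm_pos_iff.mpr hx
    have h1 := hT (‖x‖⁻¹ • x) (by simp [norm_smul, hn.ne'])
    rw [Matrix.mulVec_smul, smul_dotProduct, dotProduct_smul, smul_eq_mul, smul_eq_mul] at h1
    have : 0 < ‖x‖⁻¹ := inv_pos.mpr hn
    simpa using (mul_pos_iff_of_pos_left this).mp ((mul_pos_iff_of_pos_left this).mp h1)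

end SymMatrix

/-- The manifold `𝒩₀ⁿ = Sym⁺(n, ℝ)`, an open subset of `Sym(n, ℝ)`; the matrix `Σ` stands for
the centered normal distribution on `ℝⁿ` with covariance matrix `Σ`. -/
def centeredGaussians (n : ℕ) : TopologicalSpace.Opens (SymMatrix n) :=
  ⟨{S | S.mat.PosDef}, SymMatrix.isOpen_posDef⟩

/-- The model with corners of the manifold `𝒩₀ⁿ`. -/
abbrev gaussModel (n : ℕ) : ModelWithCorners ℝ (SymMatrix n) (SymMatrix n) :=
  𝓘(ℝ, SymMatrix n)

/-- The density `p(x; Σ) = ((2π)ⁿ det Σ)^(-1/2) exp(- xᵀ Σ⁻¹ x / 2)`. -/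
def gaussDensity {n : ℕ} (S : centeredGaussians n) (x : Fin n → ℝ) : ℝ :=
  1 / √((2 * Real.pi) ^ n * S.1.mat.det) *
    Real.exp (-(1 / 2) * (x ⬝ᵥ (S.1.mat⁻¹ *ᵥ x)))

/-- The score `X log p(x; ·)` at `Σ`, for a tangent vector `X` at `Σ`. -/
def gaussScore {n : ℕ} (S : centeredGaussians n) (X : TangentSpace (gaussModel n) S)
    (x : Fin n → ℝ) : ℝ :=
  mfderiv (gaussModel n) 𝓘(ℝ, ℝ) (fun T : centeredGaussians n => Real.log (gaussDensity T x)) S X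

/-- The Fisher metric
`g^F_Σ(X, Y) = ∫ (X log p(x; ·)) (Y log p(x; ·)) p(x; Σ) dx`, with Lebesgue measure on `ℝⁿ`. -/
def fisherMetric {n : ℕ} (S : centeredGaussians n) (X Y : TangentSpace (gaussModel n) S) : ℝ :=
  ∫ x : Fin n → ℝ, gaussScore S X x * gaussScore S Y x * gaussDensity S x

end CenteredGaussians

section LeviCivita

set_option linter.unusedSectionVars false

variable {E : Type*} [NormedAddCommGroup E] [NormedSpace ℝ E] [FiniteDimensional ℝ E]
  {H : Type*} [TopologicalSpace H] {I : ModelWithCorners ℝ E H}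
  {M : Type*} [TopologicalSpace M] [ChartedSpace H M] [IsManifold I ∞ M]

/-- Related vector fields act compatibly on functions. -/
lemma VectorFieldRelated.deriv_comp {f : M ≃ₘ⟮I, I⟯ M} {X X' : SmoothVectorField I M}
    (hX : VectorFieldRelated f X X') {h : M → ℝ} {p : M}
    (hh : MDifferentiableAt I 𝓘(ℝ, ℝ) h (f p)) :
    X.deriv (h ∘ f) p = X'.deriv h (f p) := by
  have hf : MDifferentiableAt I I f p := f.contMDiff.mdifferentiableAt (by simp)
  have e := congrArg (fun L => L (X p)) (mfderiv_comp p hh hf)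
  exact e.trans (congrArg (mfderiv I 𝓘(ℝ, ℝ) h (f p)) (hX p))

lemma VectorFieldRelated.mpullback_eq {f : M ≃ₘ⟮I, I⟯ M} {X X' : SmoothVectorField I M}
    (hX : VectorFieldRelated f X X') :
    VectorField.mpullback I I f X' = X := by
  funext p
  rw [VectorField.mpullback_apply]
  have hinv : ∀ v : TangentSpace I p,
      (mfderiv I I f p).inverse (mfderiv I I f p v) = v := by
    intro v
    have := ContinuousLinearMap.inverse_eq (f := mfderiv I I f p)
      (g := mfderiv I I f.symm (f p))
      (ContinuousLinearMap.ext (mfderiv_diffeo_symm f p))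
      (ContinuousLinearMap.ext (mfderiv_symm_diffeo f p))
    rw [this]
    exact mfderiv_symm_diffeo f p v
  rw [← hX p, hinv]

/-- The bracket of related vector fields is related to the bracket. -/
lemma VectorFieldRelated.bracket {f : M ≃ₘ⟮I, I⟯ M} {X X' Y Y' : SmoothVectorField I M}
    (hX : VectorFieldRelated f X X') (hY : VectorFieldRelated f Y Y') :
    VectorFieldRelated f (X.bracket Y) (X'.bracket Y') := by
  have : CompleteSpace E := FiniteDimensional.complete ℝ E
  have : IsManifold I (minSmoothness ℝ 2) M := by
    rw [minSmoothness_of_isRCLikeNormedField]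
    exact IsManifold.of_le (n := ∞) ENat.LEInfty.out
  have : IsManifold I (minSmoothness ℝ 3) M := by
    rw [minSmoothness_of_isRCLikeNormedField]
    exact IsManifold.of_le (n := ∞) ENat.LEInfty.out
  rw [← VectorFieldRelated.symm_iff]
  intro q
  obtain ⟨p, rfl⟩ : ∃ p, f p = q := f.surjective q
  have hq := VectorField.mpullback_mlieBracket (I := I) (I' := I) (f := f) (x₀ := p)
    (V := X') (W := Y') (n := 2) (X'.contMDiff.mdifferentiableAt (by simp))
    (Y'.contMDiff.mdifferentiableAt (by simp))
    (f.contMDiff.contMDiffAt.of_le (mod_cast ENat.LEInfty.out))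
    (by rw [minSmoothness_of_isRCLikeNormedField])
  rw [hX.mpullback_eq, hY.mpullback_eq, VectorField.mpullback_apply,
    ContinuousLinearMap.inverse_eq (f := mfderiv I I f p)
      (g := mfderiv I I f.symm (f p))
      (ContinuousLinearMap.ext (mfderiv_diffeo_symm f p))
      (ContinuousLinearMap.ext (mfderiv_symm_diffeo f p))] at hq
  refine Eq.trans hq ?_
  have : ∀ (r : M), r = p → (X.bracket Y p : E) = X.bracket Y r := by rintro _ rfl; rfl
  exact this _ (f.symm_apply_apply p)

lemma SmoothRiemannianMetric.contMDiff_pairing (g : SmoothRiemannianMetric I M)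
    (Y Z : SmoothVectorField I M) :
    ContMDiff I 𝓘(ℝ, ℝ) ∞ (fun q => g.inner q (Y q) (Z q)) := by
  have h : ContMDiff I (I.prod 𝓘(ℝ, ℝ)) ∞
      (fun q => Bundle.TotalSpace.mk' ℝ (E := Bundle.Trivial M ℝ) q
        (g.inner q (Y q) (Z q))) :=
    ContMDiff.clm_bundle_apply₂ (F₁ := E) (F₂ := E) g.contMDiff Y.contMDiff Z.contMDiff
  exact fun q => ((Bundle.contMDiffAt_totalSpace).1 (h q)).2

namespace AffineConnection

lemma koszul {D : AffineConnection I M} {g : SmoothRiemannianMetric I M}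
    (hD : D.IsLeviCivita g) (X Y Z : SmoothVectorField I M) (p : M) :
    2 * g.inner p (D.toFun X Y p) (Z p) =
      X.deriv (fun q => g.inner q (Y q) (Z q)) p + Y.deriv (fun q => g.inner q (Z q) (X q)) p
        - Z.deriv (fun q => g.inner q (X q) (Y q)) p + g.inner p (X.bracket Y p) (Z p)
        - g.inner p (Y.bracket Z p) (X p) + g.inner p (Z.bracket X p) (Y p) := by
  have h1 := hD.2 X Y Z p
  have h2 := hD.2 Y Z X p
  have h3 := hD.2 Z X Y p
  rw [nablaMetric] at h1 h2 h3
  have tor : ∀ A B : SmoothVectorField I M, A.bracket B p = D.toFun A B p - D.toFun B A p :=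
    fun A B => by rw [← hD.1 A B]; rfl
  rw [tor, tor, tor]
  simp only [map_sub, sub_apply]
  rw [g.symm p (Y p) (D.toFun X Z p)] at h1
  rw [g.symm p (Z p) (D.toFun Y X p)] at h2
  rw [g.symm p (X p) (D.toFun Z Y p)] at h3
  linarith

lemma eq_of_inner_eq (g : SmoothRiemannianMetric I M)
    (hext : ∀ (p : M) (v : TangentSpace I p), ∃ Z : SmoothVectorField I M, Z p = v)
    {p : M} {v w : TangentSpace I p}
    (h : ∀ Z : SmoothVectorField I M, g.inner p v (Z p) = g.inner p w (Z p)) : v = w := by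
  by_contra hne
  have h0 : v - w ≠ 0 := sub_ne_zero.2 hne
  obtain ⟨Z, hZ⟩ := hext p (v - w)
  have := g.pos p _ h0
  have e := h Z
  rw [hZ] at e
  have : g.inner p (v - w) (v - w) = 0 := by
    have e' := ContinuousLinearMap.map_sub (g.inner p) v w
    rw [e']
    exact sub_eq_zero.2 e
  linarith

lemma IsLeviCivita.unique {D D' : AffineConnection I M} {g : SmoothRiemannianMetric I M}
    (hext : ∀ (p : M) (v : TangentSpace I p), ∃ Z : SmoothVectorField I M, Z p = v)
    (hD : D.IsLeviCivita g) (hD' : D'.IsLeviCivita g) : D' = D := by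
  ext X Y p : 4
  refine eq_of_inner_eq g hext fun Z => ?_
  have h1 := koszul hD X Y Z p
  have h2 := koszul hD' X Y Z p
  linarith

/-- Isometries are affine for the Levi-Civita connection. -/
lemma IsLeviCivita.isAffineMap {D : AffineConnection I M} {g : SmoothRiemannianMetric I M}
    (hext : ∀ (p : M) (v : TangentSpace I p), ∃ Z : SmoothVectorField I M, Z p = v)
    (hD : D.IsLeviCivita g) {f : M ≃ₘ⟮I, I⟯ M} (hf : PreservesMetric g f) :
    IsAffineMap f D D := by
  intro X X' Y Y' hX hY p
  refine eq_of_inner_eq g hext fun Z' => ?_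
  obtain ⟨Z, hZ⟩ : ∃ Z, VectorFieldRelated f Z Z' :=
    ⟨Z'.push f.symm, (VectorFieldRelated.symm_iff f _ _).1 (Z'.related_push f.symm)⟩
  have inn : ∀ {A A' B B' : SmoothVectorField I M}, VectorFieldRelated f A A' →
      VectorFieldRelated f B B' → ∀ q, g.inner (f q) (A' (f q)) (B' (f q)) =
        g.inner q (A q) (B q) := by
    intro A A' B B' hA hB q
    rw [← hA q, ← hB q, hf]
  have der : ∀ {A A' B B' C C' : SmoothVectorField I M}, VectorFieldRelated f A A' →
      VectorFieldRelated f B B' → VectorFieldRelated f C C' →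
      C'.deriv (fun q => g.inner q (A' q) (B' q)) (f p) =
        C.deriv (fun q => g.inner q (A q) (B q)) p := by
    intro A A' B B' C C' hA hB hC
    rw [← hC.deriv_comp ((g.contMDiff_pairing A' B').mdifferentiableAt (by simp))]
    congr 1
    funext q
    exact inn hA hB q
  have h1 := koszul hD X Y Z p
  have h2 := koszul hD X' Y' Z' (f p)
  rw [der hY hZ hX, der hZ hX hY, der hX hY hZ, inn (hX.bracket hY) hZ, inn (hY.bracket hZ) hX,
    inn (hZ.bracket hX) hY] at h2
  rw [← hZ p, hf, hZ p]
  linarith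

lemma IsLeviCivita.isStatistical {D : AffineConnection I M} {g : SmoothRiemannianMetric I M}
    (hD : D.IsLeviCivita g) : D.IsStatistical g :=
  ⟨hD.1, fun X Y Z p => by rw [hD.2, hD.2]⟩

end AffineConnection

end LeviCivita

section OpenSubset

set_option linter.unusedSectionVars false

variable {E : Type*} [NormedAddCommGroup E] [NormedSpace ℝ E] {U : TopologicalSpace.Opens E}
  {F : Type*} [NormedAddCommGroup F] [NormedSpace ℝ F]

namespace OpenSubset

lemma trivializationAt_snd (p q : U) (v : TangentSpace 𝓘(ℝ, E) q) :
    (trivializationAt E (TangentSpace 𝓘(ℝ, E)) p ⟨q, v⟩).2 = v := by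
  have hq : q ∈ (chartAt E p).source := by
    rw [TopologicalSpace.Opens.chartAt_eq, OpenPartialHomeomorph.subtypeRestr_source]
    exact Set.mem_univ q.1
  have := (tangentBundleCore 𝓘(ℝ, E) U).coordChange_self (achart E p) q hq v
  exact this

lemma contMDiffAt_section_iff {V : ∀ p : U, TangentSpace 𝓘(ℝ, E) p} {p : U} :
    ContMDiffAt 𝓘(ℝ, E) (𝓘(ℝ, E).prod 𝓘(ℝ, E)) ∞
        (fun q => Bundle.TotalSpace.mk' E (E := (TangentSpace 𝓘(ℝ, E) : U → Type _)) q (V q)) p ↔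
      ContMDiffAt 𝓘(ℝ, E) 𝓘(ℝ, E) ∞ (fun q => (V q : E)) p := by
  rw [Bundle.contMDiffAt_section]
  simp only [trivializationAt_snd]

lemma contMDiffAt_iff {f : E → F} {p : U} :
    ContMDiffAt 𝓘(ℝ, E) 𝓘(ℝ, F) ∞ (fun q : U => f q) p ↔ ContDiffAt ℝ ∞ f p := by
  rw [contMDiffAt_subtype_iff, contMDiffAt_iff_contDiffAt]

lemma extend_apply (f : U → F) (p : U) : Subtype.val.extend f 0 p.1 = f p :=
  Subtype.val_injective.extend_apply _ _ _

lemma contDiffAt_extend {f : U → F} {p : U} (hf : ContMDiffAt 𝓘(ℝ, E) 𝓘(ℝ, F) ∞ f p) :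
    ContDiffAt ℝ ∞ (Subtype.val.extend f 0) p.1 := by
  rw [← contMDiffAt_iff (U := U)]
  simpa only [extend_apply] using hf

lemma hasMFDerivAt_val (p : U) :
    HasMFDerivAt 𝓘(ℝ, E) 𝓘(ℝ, E) (Subtype.val : U → E) p (ContinuousLinearMap.id ℝ E) := by
  refine ⟨continuous_subtype_val.continuousAt, ?_⟩
  have h1 := TopologicalSpace.Opens.chartAt_subtype_val_symm_eventuallyEq (H := E) U (x := p)
  have h2 : HasFDerivAt (Subtype.val ∘ (chartAt E p).symm) (ContinuousLinearMap.id ℝ E) p.1 :=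
    (hasFDerivAt_id p.1).congr_of_eventuallyEq h1.symm
  simp only [writtenInExtChartAt, extChartAt, mfld_simps]
  exact h2.hasFDerivWithinAt

lemma hasMFDerivAt_comp_val {f : E → F} {f' : E →L[ℝ] F} {p : U} (hf : HasFDerivAt f f' p) :
    HasMFDerivAt 𝓘(ℝ, E) 𝓘(ℝ, F) (fun q : U => f q) p f' :=
  (hf.hasMFDerivAt.comp p (hasMFDerivAt_val p) :)

lemma mfderiv_comp_val {f : E → F} {f' : E →L[ℝ] F} {p : U} (hf : HasFDerivAt f f' p)
    (v : TangentSpace 𝓘(ℝ, E) p) :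
    (mfderiv 𝓘(ℝ, E) 𝓘(ℝ, F) (fun q : U => f q) p v : F) = f' v := by
  rw [(hasMFDerivAt_comp_val hf).mfderiv]; rfl

/-- The derivative of a self-map of an open set that is the restriction of `f`. -/
lemma mfderiv_of_val_eq {f : E → E} {φ : U → U} {f' : E →L[ℝ] E} {p : U}
    (hφ : ∀ q, (φ q : E) = f q) (hd : MDifferentiableAt 𝓘(ℝ, E) 𝓘(ℝ, E) φ p)
    (hf : HasFDerivAt f f' p) (v : TangentSpace 𝓘(ℝ, E) p) :
    (mfderiv 𝓘(ℝ, E) 𝓘(ℝ, E) φ p v : E) = f' v := by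
  have h1 := (hasMFDerivAt_val (φ p)).comp p hd.hasMFDerivAt
  have h2 := hasMFDerivAt_comp_val hf
  have e : (Subtype.val ∘ φ) = fun q : U => f q := funext hφ
  rw [e] at h1
  exact congrArg (fun L => L v) (hasMFDerivAt_unique h1 h2)

lemma contMDiff_of_val_eq {f : E → E} {φ : U → U} (hφ : ∀ q, (φ q : E) = f q)
    (hf : ∀ p : U, ContDiffAt ℝ ∞ f p) : ContMDiff 𝓘(ℝ, E) 𝓘(ℝ, E) ∞ φ := by
  rw [← ContMDiff.subtypeVal_comp_iff]
  have e : (Subtype.val ∘ φ) = fun q : U => f q := funext hφ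
  rw [e]
  exact fun p => contMDiffAt_iff.2 (hf p)

end OpenSubset

open OpenSubset

namespace SmoothVectorField

/-- The vector field on an open set given by a vector-valued function that is smooth there. -/
def ofFun (V : E → E) (hV : ∀ p : U, ContDiffAt ℝ ∞ V p) : SmoothVectorField 𝓘(ℝ, E) U :=
  ⟨fun p => V p, fun p => contMDiffAt_section_iff.2 (contMDiffAt_iff.2 (hV p))⟩

/-- A vector field on an open set as a vector-valued function. -/
noncomputable def toVec (X : SmoothVectorField 𝓘(ℝ, E) U) : E → E :=
  Subtype.val.extend (fun p : U => (X p : E)) 0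

lemma toVec_apply (X : SmoothVectorField 𝓘(ℝ, E) U) (p : U) : X.toVec p = X p :=
  extend_apply (fun p : U => (X p : E)) p

lemma contDiffAt_toVec (X : SmoothVectorField 𝓘(ℝ, E) U) (p : U) :
    ContDiffAt ℝ ∞ X.toVec p :=
  contDiffAt_extend (contMDiffAt_section_iff.1 (X.contMDiff p))

lemma differentiableAt_toVec (X : SmoothVectorField 𝓘(ℝ, E) U) (p : U) :
    DifferentiableAt ℝ X.toVec p :=
  (X.contDiffAt_toVec p).differentiableAt (by simp)

lemma eventually_toVec_eq {X : SmoothVectorField 𝓘(ℝ, E) U} {V : E → E}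
    (h : ∀ p : U, X p = V p) (p : U) : X.toVec =ᶠ[𝓝 p.1] V := by
  filter_upwards [U.isOpen.mem_nhds p.2] with x hx
  exact (X.toVec_apply ⟨x, hx⟩).trans (h ⟨x, hx⟩)

lemma exists_apply_eq (p : U) (v : TangentSpace 𝓘(ℝ, E) p) :
    ∃ Z : SmoothVectorField 𝓘(ℝ, E) U, Z p = v :=
  ⟨ofFun (fun _ => v) fun _ => contDiffAt_const, rfl⟩

lemma deriv_eq {f : E → ℝ} {f' : E →L[ℝ] ℝ} (X : SmoothVectorField 𝓘(ℝ, E) U) {p : U}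
    (hf : HasFDerivAt f f' p) : X.deriv (fun q : U => f q) p = f' (X p) :=
  mfderiv_comp_val hf _

lemma bracket_eq [FiniteDimensional ℝ E] (X Y : SmoothVectorField 𝓘(ℝ, E) U) (p : U) :
    X.bracket Y p = fderiv ℝ Y.toVec p (X p) - fderiv ℝ X.toVec p (Y p) := by
  have : CompleteSpace E := FiniteDimensional.complete ℝ E
  have : IsManifold 𝓘(ℝ, E) (minSmoothness ℝ 3) U := by
    rw [minSmoothness_of_isRCLikeNormedField]
    exact IsManifold.of_le (n := ∞) ENat.LEInfty.out
  have : IsManifold 𝓘(ℝ, E) (minSmoothness ℝ 3) E := by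
    rw [minSmoothness_of_isRCLikeNormedField]
    exact IsManifold.of_le (n := ∞) ENat.LEInfty.out
  have inv : ∀ q : U,
      (mfderiv 𝓘(ℝ, E) 𝓘(ℝ, E) (Subtype.val : U → E) q).inverse
        = ContinuousLinearMap.id ℝ E := by
    intro q
    rw [(hasMFDerivAt_val q).mfderiv]
    exact ContinuousLinearMap.inverse_id
  have pull : ∀ Z : SmoothVectorField 𝓘(ℝ, E) U,
      VectorField.mpullback 𝓘(ℝ, E) 𝓘(ℝ, E) (Subtype.val : U → E) Z.toVec = Z := by
    intro Z
    funext q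
    change (mfderiv 𝓘(ℝ, E) 𝓘(ℝ, E) (Subtype.val : U → E) q).inverse (Z.toVec q.1) = Z q
    rw [inv]
    exact Z.toVec_apply q
  have md : ∀ Z : SmoothVectorField 𝓘(ℝ, E) U, MDifferentiableAt 𝓘(ℝ, E)
      (𝓘(ℝ, E).prod 𝓘(ℝ, E))
      (fun x => Bundle.TotalSpace.mk' E (E := (TangentSpace 𝓘(ℝ, E) : E → Type _)) x (Z.toVec x))
      p.1 := fun Z =>
    (contMDiffAt_vectorSpace_iff_contDiffAt.2 (Z.contDiffAt_toVec p)).mdifferentiableAt (by simp)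
  have h := VectorField.mpullback_mlieBracket (I := 𝓘(ℝ, E)) (I' := 𝓘(ℝ, E)) (n := 2)
    (f := (Subtype.val : U → E)) (x₀ := p) (md X) (md Y) contMDiff_subtype_val.contMDiffAt
    (by rw [minSmoothness_of_isRCLikeNormedField])
  rw [pull, pull, VectorField.mpullback_apply, inv] at h
  refine h.symm.trans ?_
  have vec : ∀ V W : ∀ x : E, TangentSpace 𝓘(ℝ, E) x,
      VectorField.mlieBracket 𝓘(ℝ, E) V W p.1 = VectorField.lieBracket ℝ V W p.1 := by
    intro V W
    rw [← VectorField.mlieBracketWithin_univ, VectorField.mlieBracketWithin_eq_lieBracketWithin]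
    exact congrFun (VectorField.lieBracketWithin_univ (𝕜 := ℝ) (V := V) (W := W)) p.1
  rw [← X.toVec_apply, ← Y.toVec_apply]
  exact vec X.toVec Y.toVec

end SmoothVectorField

end OpenSubset

section OpenSubsetMetric

variable {E : Type*} [NormedAddCommGroup E] [NormedSpace ℝ E] {U : TopologicalSpace.Opens E}

namespace OpenSubset

lemma trivializationAt_symm (p q : U) (v : E) :
    (trivializationAt E (TangentSpace 𝓘(ℝ, E)) p).symm q v = v := by
  have hq : q ∈ (chartAt E p).source := by
    rw [TopologicalSpace.Opens.chartAt_eq, OpenPartialHomeomorph.subtypeRestr_source]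
    exact Set.mem_univ q.1
  have h := TangentBundle.symmL_trivializationAt_eq_core (I := 𝓘(ℝ, E)) hq
  have h2 := (tangentBundleCore 𝓘(ℝ, E) U).coordChange_self (achart E p) q hq v
  have h3 := congrArg (fun L => L v) h
  refine Eq.trans ?_ (h3.trans h2)
  exact (Bundle.Trivialization.symmL_apply _ hq v).symm

lemma isVonNBounded_of_pos [FiniteDimensional ℝ E] (b : E →L[ℝ] E →L[ℝ] ℝ)
    (hb : ∀ v, v ≠ 0 → 0 < b v v) : Bornology.IsVonNBounded ℝ {v : E | b v v < 1} := by
  rcases subsingleton_or_nontrivial E with h | h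
  · exact (NormedSpace.isVonNBounded_ball ℝ E 1).subset fun v _ => by
      simp [Subsingleton.elim v 0]
  have hc : Continuous fun v : E => b v v := by fun_prop
  have : ProperSpace E := FiniteDimensional.proper ℝ E
  obtain ⟨w, hw, hmin⟩ := (isCompact_sphere (0 : E) 1).exists_isMinOn
    (NormedSpace.sphere_nonempty.2 zero_le_one) hc.continuousOn
  have hw0 : w ≠ 0 := by rintro rfl; simp at hw
  have hpos := hb w hw0
  refine (NormedSpace.isVonNBounded_ball ℝ E (√(b w w)⁻¹)).subset fun v hv => ?_
  rw [mem_ball_zero_iff]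
  by_cases hv0 : v = 0
  · subst hv0; simpa using hpos
  have hn : 0 < ‖v‖ := norm_pos_iff.2 hv0
  have h1 : b w w ≤ b (‖v‖⁻¹ • v) (‖v‖⁻¹ • v) := hmin (by simp [norm_smul, hn.ne'])
  simp only [map_smul, smul_apply, smul_eq_mul] at h1
  have h2 : b v v < 1 := hv
  apply Real.lt_sqrt_of_sq_lt
  have h3 : b w w * ‖v‖ ^ 2 ≤ b v v := by
    calc b w w * ‖v‖ ^ 2 ≤ (‖v‖⁻¹ * (‖v‖⁻¹ * b v v)) * ‖v‖ ^ 2 := by gcongr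
      _ = b v v := by field_simp
  rw [inv_eq_one_div, lt_div_iff₀ hpos, mul_comm]
  exact h3.trans_lt h2

lemma contMDiffAt_bilin_section {b : E → E →L[ℝ] E →L[ℝ] ℝ}
    {B : ∀ p : U, TangentSpace 𝓘(ℝ, E) p →L[ℝ] TangentSpace 𝓘(ℝ, E) p →L[ℝ] ℝ}
    (hB : ∀ (q : U) (v w : TangentSpace 𝓘(ℝ, E) q), B q v w = b q v w) {p : U}
    (hs : ContDiffAt ℝ ∞ b p) :
    ContMDiffAt 𝓘(ℝ, E) (𝓘(ℝ, E).prod 𝓘(ℝ, E →L[ℝ] E →L[ℝ] ℝ)) ∞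
      (fun q => Bundle.TotalSpace.mk' (E →L[ℝ] E →L[ℝ] ℝ)
        (E := fun q : U => TangentSpace 𝓘(ℝ, E) q →L[ℝ] TangentSpace 𝓘(ℝ, E) q →L[ℝ] ℝ)
        q (B q)) p := by
  refine (Bundle.contMDiffAt_section _).2 ?_
  refine (contMDiffAt_iff.2 hs).congr_of_eventuallyEq (Filter.Eventually.of_forall fun q => ?_)
  have hq : q ∈ (chartAt E p).source := by
    rw [TopologicalSpace.Opens.chartAt_eq, OpenPartialHomeomorph.subtypeRestr_source]
    exact Set.mem_univ q.1
  ext v w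
  have := inCoordinates_apply_eq₂ (𝕜 := ℝ) (F₁ := E) (F₂ := E) (F₃ := ℝ)
    (E₁ := (TangentSpace 𝓘(ℝ, E) : U → Type _)) (E₂ := (TangentSpace 𝓘(ℝ, E) : U → Type _))
    (E₃ := Bundle.Trivial U ℝ) (x₀ := p) (x := q) (ϕ := B q) (v := v) (w := w) hq hq
    (Set.mem_univ q)
  rw [trivializationAt_symm, trivializationAt_symm] at this
  refine (this.trans ?_).trans (hB q v w)
  simp

/-- The Riemannian metric on an open set given by a smooth family of inner products. -/
def metric [FiniteDimensional ℝ E] (b : E → E →L[ℝ] E →L[ℝ] ℝ)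
    (hs : ∀ p : U, ContDiffAt ℝ ∞ b p)
    (hsymm : ∀ (p : U) (v w : E), b p v w = b p w v)
    (hpos : ∀ (p : U) (v : E), v ≠ 0 → 0 < b p v v) :
    SmoothRiemannianMetric 𝓘(ℝ, E) U where
  inner p := b p
  symm := hsymm
  pos := hpos
  isVonNBounded p := isVonNBounded_of_pos (b p) (hpos p)
  contMDiff p := contMDiffAt_bilin_section (fun _ _ _ => rfl) (hs p)

end OpenSubset

end OpenSubsetMetric

section SymMatrixCalculus

open scoped MatrixOrder in
lemma Matrix.PosDef.exists_isUnit_mul_transpose {n : ℕ} {S : Matrix (Fin n) (Fin n) ℝ}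
    (hS : S.PosDef) : ∃ B : Matrix (Fin n) (Fin n) ℝ, IsUnit B ∧ S = B * Bᵀ := by
  obtain ⟨B, hB⟩ := CStarAlgebra.nonneg_iff_eq_star_mul_self.mp hS.posSemidef.nonneg
  rw [Matrix.star_eq_conjTranspose, Matrix.conjTranspose_eq_transpose_of_trivial] at hB
  refine ⟨Bᵀ, ?_, by rw [Matrix.transpose_transpose, hB]⟩
  have h := hS.isUnit
  rw [Matrix.isUnit_iff_isUnit_det] at h ⊢
  rw [hB, Matrix.det_mul] at h
  exact isUnit_of_mul_isUnit_left h

attribute [local instance] Matrix.linftyOpNormedRing Matrix.linftyOpNormedAlgebra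

namespace SymMatrix

variable {n : ℕ}

lemma mat_injective : Function.Injective (mat : SymMatrix n → Matrix (Fin n) (Fin n) ℝ) :=
  Subtype.val_injective

/-- A symmetric matrix as an element of `Sym(n, ℝ)`. -/
def ofSymm (A : Matrix (Fin n) (Fin n) ℝ) (hA : Aᵀ = A) : SymMatrix n :=
  (⟨A, hA⟩ : symSubmodule n)

lemma mat_ofSymm (A : Matrix (Fin n) (Fin n) ℝ) (hA : Aᵀ = A) : mat (ofSymm A hA) = A := rfl

/-- The inclusion of the symmetric matrices as a continuous linear map. -/
noncomputable def matL : SymMatrix n →L[ℝ] Matrix (Fin n) (Fin n) ℝ :=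
  LinearMap.toContinuousLinearMap mat

/-- The symmetric part of a matrix. -/
noncomputable def symPart : Matrix (Fin n) (Fin n) ℝ →L[ℝ] SymMatrix n :=
  LinearMap.toContinuousLinearMap
    { toFun := fun A => ofSymm ((1 / 2 : ℝ) • (A + Aᵀ)) (by
        rw [Matrix.transpose_smul, Matrix.transpose_add, Matrix.transpose_transpose, add_comm])
      map_add' := fun A B => mat_injective (by
        rw [map_add, mat_ofSymm, mat_ofSymm, mat_ofSymm, Matrix.transpose_add]; module)
      map_smul' := fun c A => mat_injective (by
        rw [map_smul, mat_ofSymm, mat_ofSymm, Matrix.transpose_smul]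
        simp only [RingHom.id_apply]; module) }

lemma mat_symPart (A : Matrix (Fin n) (Fin n) ℝ) :
    mat (symPart A) = (1 / 2 : ℝ) • (A + Aᵀ) := rfl

lemma symPart_transpose (A : Matrix (Fin n) (Fin n) ℝ) : symPart Aᵀ = symPart A :=
  mat_injective (by rw [mat_symPart, mat_symPart, Matrix.transpose_transpose, add_comm])

lemma transpose_inv (S : SymMatrix n) : ((mat S)⁻¹)ᵀ = (mat S)⁻¹ := by
  rw [Matrix.transpose_nonsing_inv, mat_transpose]

lemma symPart_swap (X Y S : SymMatrix n) :
    symPart (mat X * (mat S)⁻¹ * mat Y) = symPart (mat Y * (mat S)⁻¹ * mat X) := by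
  rw [← symPart_transpose]
  simp only [Matrix.transpose_mul, mat_transpose, transpose_inv, Matrix.mul_assoc]

lemma isUnit_det {S : SymMatrix n} (hS : (mat S).PosDef) : IsUnit (mat S).det :=
  hS.det_pos.ne'.isUnit

lemma contDiffAt_inv {S : SymMatrix n} (hS : (mat S).PosDef) :
    ContDiffAt ℝ ∞ (fun T : SymMatrix n => (mat T)⁻¹) S := by
  have h := contDiffAt_ringInverse ℝ (n := ∞) hS.isUnit.unit
  rw [IsUnit.unit_spec] at h
  have := h.comp S (matL : SymMatrix n →L[ℝ] _).contDiff.contDiffAt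
  refine this.congr_of_eventuallyEq (Filter.Eventually.of_forall fun T => ?_)
  exact Matrix.nonsing_inv_eq_ringInverse (mat T)

lemma hasFDerivAt_inv {S : SymMatrix n} (hS : (mat S).PosDef) :
    HasFDerivAt (fun T : SymMatrix n => (mat T)⁻¹)
      (-(ContinuousLinearMap.mulLeftRight ℝ _ (mat S)⁻¹ (mat S)⁻¹ ∘L matL)) S := by
  have h := hasFDerivAt_ringInverse (𝕜 := ℝ) hS.isUnit.unit
  rw [IsUnit.unit_spec] at h
  have hu : ((hS.isUnit.unit⁻¹ : (Matrix (Fin n) (Fin n) ℝ)ˣ) : Matrix (Fin n) (Fin n) ℝ)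
      = (mat S)⁻¹ := by
    rw [Matrix.coe_units_inv, IsUnit.unit_spec]
  rw [hu] at h
  have := HasFDerivAt.comp S (f := (matL : SymMatrix n → _)) h matL.hasFDerivAt
  refine (this.congr_of_eventuallyEq (Filter.Eventually.of_forall fun T => ?_)).congr_fderiv ?_
  · exact Matrix.nonsing_inv_eq_ringInverse (mat T)
  · rfl

/-- The bilinear form `(X, Y) ↦ tr(S⁻¹ X S⁻¹ Y) / 2`. -/
noncomputable def traceForm (S : SymMatrix n) : SymMatrix n →L[ℝ] SymMatrix n →L[ℝ] ℝ :=
  LinearMap.toContinuousBilinearMap (LinearMap.mk₂ ℝ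
    (fun X Y => (1 / 2 : ℝ) * ((mat S)⁻¹ * mat X * (mat S)⁻¹ * mat Y).trace)
    (fun X X' Y => by simp only [map_add, mul_add, add_mul, Matrix.trace_add])
    (fun c X Y => by
      simp only [map_smul, Matrix.mul_smul, Matrix.smul_mul, Matrix.trace_smul, smul_eq_mul]
      ring)
    (fun X Y Y' => by simp only [map_add, mul_add, Matrix.trace_add])
    (fun c X Y => by
      simp only [map_smul, Matrix.mul_smul, Matrix.trace_smul, smul_eq_mul]
      ring))

lemma traceForm_apply (S X Y : SymMatrix n) :
    traceForm S X Y = (1 / 2 : ℝ) * ((mat S)⁻¹ * mat X * (mat S)⁻¹ * mat Y).trace := rfl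

lemma traceForm_symm (S X Y : SymMatrix n) : traceForm S X Y = traceForm S Y X := by
  rw [traceForm_apply, traceForm_apply, Matrix.mul_assoc, Matrix.trace_mul_comm]
  simp only [Matrix.mul_assoc]

lemma traceForm_pos {S : SymMatrix n} (hS : (mat S).PosDef) (X : SymMatrix n) (hX : X ≠ 0) :
    0 < traceForm S X X := by
  obtain ⟨B, hB, hSB⟩ := hS.inv.exists_isUnit_mul_transpose
  have hBt : IsUnit Bᵀ := (Matrix.isUnit_transpose B).2 hB
  have key : ((mat S)⁻¹ * mat X * (mat S)⁻¹ * mat X).trace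
      = ((Bᵀ * mat X * B)ᴴ * (Bᵀ * mat X * B)).trace := by
    rw [hSB, Matrix.conjTranspose_eq_transpose_of_trivial]
    simp only [Matrix.transpose_mul, Matrix.transpose_transpose, mat_transpose]
    rw [show B * Bᵀ * mat X * (B * Bᵀ) * mat X = B * (Bᵀ * mat X * B * Bᵀ * mat X) by
      simp only [Matrix.mul_assoc], Matrix.trace_mul_comm]
    simp only [Matrix.mul_assoc]
  have h0 : Bᵀ * mat X * B ≠ 0 := by
    intro h
    apply hX
    apply mat_injective
    rw [map_zero]
    have h1 := hB.mul_left_eq_zero.1 h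
    exact hBt.mul_right_eq_zero.1 h1
  rw [traceForm_apply, key]
  have h1 := (Matrix.posSemidef_conjTranspose_mul_self (Bᵀ * mat X * B)).trace_nonneg
  have h2 : ((Bᵀ * mat X * B)ᴴ * (Bᵀ * mat X * B)).trace ≠ 0 := fun h =>
    h0 (Matrix.trace_conjTranspose_mul_self_eq_zero_iff.1 h)
  have := lt_of_le_of_ne h1 h2.symm
  positivity

/-- The trace as a continuous linear map. -/
noncomputable def traceL : Matrix (Fin n) (Fin n) ℝ →L[ℝ] ℝ :=
  LinearMap.toContinuousLinearMap (Matrix.traceLinearMap (Fin n) ℝ ℝ)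

lemma contDiffAt_traceForm {S : SymMatrix n} (hS : (mat S).PosDef) :
    ContDiffAt ℝ ∞ (traceForm : SymMatrix n → _) S := by
  have h : ContDiffOn ℝ ∞ (traceForm : SymMatrix n → _) {T | (mat T).PosDef} := by
    rw [contDiffOn_clm_apply]
    intro X
    rw [contDiffOn_clm_apply]
    intro Y T hT
    refine ContDiffAt.contDiffWithinAt ?_
    have hi := contDiffAt_inv hT
    exact contDiffAt_const.mul (traceL.contDiff.contDiffAt.comp T
      (((hi.mul contDiffAt_const).mul hi).mul contDiffAt_const))
  exact h.contDiffAt (isOpen_posDef.mem_nhds hS)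

/-- The Leibniz rule for `traceForm`. -/
lemma hasFDerivAt_traceForm {S : SymMatrix n} (hS : (mat S).PosDef)
    {Y Z : SymMatrix n → SymMatrix n}
    (hY : DifferentiableAt ℝ Y S) (hZ : DifferentiableAt ℝ Z S) :
    ∃ L : SymMatrix n →L[ℝ] ℝ, HasFDerivAt (fun T => traceForm T (Y T) (Z T)) L S ∧
      ∀ V, L V = traceForm S (fderiv ℝ Y S V) (Z S) + traceForm S (Y S) (fderiv ℝ Z S V)
        - traceForm S (symPart (mat V * (mat S)⁻¹ * mat (Y S))) (Z S)
        - traceForm S (Y S) (symPart (mat V * (mat S)⁻¹ * mat (Z S))) := by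
  have hi := hasFDerivAt_inv hS
  have hY' := matL.hasFDerivAt.comp S hY.hasFDerivAt
  have hZ' := matL.hasFDerivAt.comp S hZ.hasFDerivAt
  have h := (traceL.hasFDerivAt.comp S (((hi.mul' hY').mul' hi).mul' hZ')).const_mul (1 / 2 : ℝ)
  refine ⟨_, h, fun V => ?_⟩
  have e : ∀ P A B C D G : Matrix (Fin n) (Fin n) ℝ,
      (1 / 2 : ℝ) * (P * A * P * D + (P * A * -(P * G * P) + (P * B + -(P * G * P) * A) * P) * C).trace
        = (1 / 2 : ℝ) * (P * B * P * C).trace + (1 / 2 : ℝ) * (P * A * P * D).trace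
          - (1 / 2 : ℝ) * (P * ((1 / 2 : ℝ) • (G * P * A + A * P * G)) * P * C).trace
          - (1 / 2 : ℝ) * (P * A * P * ((1 / 2 : ℝ) • (G * P * C + C * P * G))).trace := by
    intro P A B C D G
    have cyc : (P * A * P * C * P * G).trace = (P * G * P * A * P * C).trace := by
      rw [Matrix.mul_assoc, Matrix.trace_mul_comm]
      simp only [Matrix.mul_assoc]
    simp only [mul_add, add_mul, mul_neg, neg_mul, Matrix.trace_add, Matrix.trace_neg,
      Matrix.mul_smul, Matrix.smul_mul, Matrix.trace_smul, smul_eq_mul, ← Matrix.mul_assoc, cyc]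
    ring
  simp only [traceForm_apply, mat_symPart, Matrix.transpose_mul, mat_transpose, transpose_inv,
    ← Matrix.mul_assoc]
  exact e (mat S)⁻¹ (mat (Y S)) (mat (fderiv ℝ Y S V)) (mat (Z S)) (mat (fderiv ℝ Z S V)) (mat V)

end SymMatrix

end SymMatrixCalculus

section Tensoriality

set_option linter.unusedSectionVars false

variable {E : Type*} [NormedAddCommGroup E] [NormedSpace ℝ E] [FiniteDimensional ℝ E]
  {U : TopologicalSpace.Opens E}

namespace OpenSubset

open SmoothVectorField

/-- A function on an open set given by a function that is smooth there. -/
def smoothFun (f : E → ℝ) (hf : ∀ p : U, ContDiffAt ℝ ∞ f p) : C^∞⟮𝓘(ℝ, E), U; 𝓘(ℝ, ℝ), ℝ⟯ :=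
  ⟨fun p => f p, fun p => contMDiffAt_iff.2 (hf p)⟩

/-- An additive, `C^∞`-homogeneous functional of a vector field only depends on the value of the
field at the point. -/
lemma tensorial {F : Type*} [AddCommGroup F] [Module ℝ F] {p : U}
    {T : SmoothVectorField 𝓘(ℝ, E) U → F}
    (hadd : ∀ X Y, T (X + Y) = T X + T Y)
    (hsmul : ∀ f X, T (fsmul f X) = f p • T X)
    {Y Z : SmoothVectorField 𝓘(ℝ, E) U} (h : Y p = Z p) : T Y = T Z := by
  let T' : SmoothVectorField 𝓘(ℝ, E) U →+ F := AddMonoidHom.mk' T hadd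
  change T' Y = T' Z
  rw [← sub_eq_zero, ← map_sub]
  have hW : (Y - Z) p = 0 := sub_eq_zero.2 h
  generalize Y - Z = W at hW
  let b := Module.finBasis ℝ E
  let c : ∀ i, E →L[ℝ] ℝ := fun i => LinearMap.toContinuousLinearMap (b.coord i)
  have e : W = ∑ i, fsmul (smoothFun (fun x => c i (W.toVec x)) fun q =>
      (c i).contDiff.contDiffAt.comp _ (W.contDiffAt_toVec q))
      (ofFun (fun _ => b i) fun _ => contDiffAt_const) := by
    ext q
    have h1 : ∀ s : Finset (Fin (Module.finrank ℝ E)), ∀ G : _ → SmoothVectorField 𝓘(ℝ, E) U,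
        (∑ i ∈ s, G i) q = ∑ i ∈ s, G i q := by
      intro s G
      exact map_sum (⟨⟨fun X : SmoothVectorField 𝓘(ℝ, E) U => X q, rfl⟩, fun _ _ => rfl⟩ :
        SmoothVectorField 𝓘(ℝ, E) U →+ TangentSpace 𝓘(ℝ, E) q) G s
    rw [h1]
    have h2 := b.sum_repr (W q : E)
    rw [← W.toVec_apply] at h2
    exact (W.toVec_apply q).symm.trans h2.symm
  rw [e, map_sum]
  refine Finset.sum_eq_zero fun i _ => ?_
  refine (hsmul _ _).trans ?_
  have : (smoothFun (U := U) (fun x => c i (W.toVec x)) fun q =>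
      (c i).contDiff.contDiffAt.comp _ (W.contDiffAt_toVec q)) p = 0 := by
    change c i (W.toVec p) = 0
    rw [W.toVec_apply, hW]
    exact map_zero _
  rw [this, zero_smul]

end OpenSubset

open OpenSubset

namespace AffineConnection

lemma apply_congr_left (D : AffineConnection 𝓘(ℝ, E) U) {X X' : SmoothVectorField 𝓘(ℝ, E) U}
    (Y : SmoothVectorField 𝓘(ℝ, E) U) {p : U} (h : X p = X' p) :
    D.toFun X Y p = D.toFun X' Y p :=
  tensorial (T := fun X => D.toFun X Y p) (fun X X' => by rw [D.add_left]; rfl)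
    (fun f X => by rw [D.smul_left]; rfl) h

/-- The difference of two affine connections is a tensor. -/
lemma sub_congr (D D' : AffineConnection 𝓘(ℝ, E) U) {X X' Y Y' : SmoothVectorField 𝓘(ℝ, E) U}
    {p : U} (hX : X p = X' p) (hY : Y p = Y' p) :
    D'.toFun X Y p - D.toFun X Y p = D'.toFun X' Y' p - D.toFun X' Y' p := by
  rw [D.apply_congr_left Y hX, D'.apply_congr_left Y hX]
  refine tensorial (T := fun Y => D'.toFun X' Y p - D.toFun X' Y p) (fun Y Y' => ?_)
    (fun f Y => ?_) hY
  · rw [D.add_right, D'.add_right]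
    exact add_sub_add_comm _ _ _ _
  · rw [D.leibniz, D'.leibniz, add_sub_add_right_eq_sub, smul_sub]

lemma sub_neg_neg (D D' : AffineConnection 𝓘(ℝ, E) U) (X Y : SmoothVectorField 𝓘(ℝ, E) U)
    (p : U) :
    D'.toFun (-X) (-Y) p - D.toFun (-X) (-Y) p = D'.toFun X Y p - D.toFun X Y p := by
  have hn : ∀ Z : SmoothVectorField 𝓘(ℝ, E) U,
      -Z = SmoothVectorField.fsmul (smoothFun (fun _ => -1) fun _ => contDiffAt_const) Z := by
    intro Z
    ext q
    exact (neg_one_smul ℝ (Z q)).symm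
  rw [hn X, hn Y, D.smul_left, D'.smul_left]
  change (-1 : ℝ) • D'.toFun X _ p - (-1 : ℝ) • D.toFun X _ p = _
  rw [D.leibniz, D'.leibniz, ← smul_sub, add_sub_add_right_eq_sub, ← smul_sub]
  change (-1 : ℝ) • (-1 : ℝ) • _ = _
  module

lemma IsTorsionFree.bracket_apply {D : AffineConnection 𝓘(ℝ, E) U} (hD : D.IsTorsionFree)
    (X Y : SmoothVectorField 𝓘(ℝ, E) U) (p : U) :
    X.bracket Y p = D.toFun X Y p - D.toFun Y X p := by
  rw [← hD X Y]; rfl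

lemma curvature_apply (D : AffineConnection 𝓘(ℝ, E) U) (X Y Z : SmoothVectorField 𝓘(ℝ, E) U)
    (p : U) : D.curvature X Y Z p =
      D.toFun X (D.toFun Y Z) p - D.toFun Y (D.toFun X Z) p - D.toFun (X.bracket Y) Z p := rfl

lemma IsTorsionFree.curvature_add_left {D : AffineConnection 𝓘(ℝ, E) U} (hD : D.IsTorsionFree)
    (X X' Y Z : SmoothVectorField 𝓘(ℝ, E) U) (p : U) :
    D.curvature (X + X') Y Z p = D.curvature X Y Z p + D.curvature X' Y Z p := by
  have hb : D.toFun ((X + X').bracket Y) Z p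
      = D.toFun (X.bracket Y) Z p + D.toFun (X'.bracket Y) Z p := by
    have : D.toFun (X.bracket Y + X'.bracket Y) Z p
      = D.toFun (X.bracket Y) Z p + D.toFun (X'.bracket Y) Z p := by rw [D.add_left]; rfl
    rw [← this]
    refine D.apply_congr_left Z ?_
    change _ = X.bracket Y p + X'.bracket Y p
    rw [hD.bracket_apply, hD.bracket_apply, hD.bracket_apply, D.add_left, D.add_right]
    exact add_sub_add_comm _ _ _ _
  rw [curvature_apply, curvature_apply, curvature_apply, hb, D.add_left, D.add_left, D.add_right]
  change (D.toFun X (D.toFun Y Z) p + D.toFun X' (D.toFun Y Z) p)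
    - (D.toFun Y (D.toFun X Z) p + D.toFun Y (D.toFun X' Z) p) - _ = _
  abel

lemma IsTorsionFree.curvature_fsmul_left {D : AffineConnection 𝓘(ℝ, E) U} (hD : D.IsTorsionFree)
    (f : C^∞⟮𝓘(ℝ, E), U; 𝓘(ℝ, ℝ), ℝ⟯) (X Y Z : SmoothVectorField 𝓘(ℝ, E) U) (p : U) :
    D.curvature (SmoothVectorField.fsmul f X) Y Z p = f p • D.curvature X Y Z p := by
  have hb : D.toFun ((SmoothVectorField.fsmul f X).bracket Y) Z p
      = f p • D.toFun (X.bracket Y) Z p - Y.deriv f p • D.toFun X Z p := by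
    have : D.toFun (SmoothVectorField.fsmul f (X.bracket Y) + SmoothVectorField.fsmul
        (smoothFun (fun _ => -Y.deriv f p) fun _ => contDiffAt_const) X) Z p
      = f p • D.toFun (X.bracket Y) Z p + (-Y.deriv f p) • D.toFun X Z p := by
      rw [D.add_left, D.smul_left, D.smul_left]; rfl
    rw [sub_eq_add_neg, ← neg_smul, ← this]
    refine D.apply_congr_left Z ?_
    change _ = f p • X.bracket Y p + (-Y.deriv f p) • X p
    rw [hD.bracket_apply, hD.bracket_apply, D.smul_left, D.leibniz]
    change f p • D.toFun X Y p - _ = _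
    module
  rw [curvature_apply, curvature_apply, hb, D.smul_left, D.smul_left, D.leibniz]
  change f p • D.toFun X (D.toFun Y Z) p - _ - _ = _
  module

lemma IsTorsionFree.curvature_eq_smul {D : AffineConnection 𝓘(ℝ, E) U} (hD : D.IsTorsionFree)
    {X W : SmoothVectorField 𝓘(ℝ, E) U} (Y Z : SmoothVectorField 𝓘(ℝ, E) U) {p : U} {c : ℝ}
    (h : X p = c • W p) : D.curvature X Y Z p = c • D.curvature W Y Z p := by
  refine Eq.trans ?_ (hD.curvature_fsmul_left
    (smoothFun (fun _ => c) fun _ => contDiffAt_const) W Y Z p)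
  exact tensorial (T := fun X => D.curvature X Y Z p)
    (fun X X' => hD.curvature_add_left X X' Y Z p)
    (fun f X => hD.curvature_fsmul_left f X Y Z p) h

lemma IsTorsionFree.curvature_swap {D : AffineConnection 𝓘(ℝ, E) U} (hD : D.IsTorsionFree)
    (X Y Z : SmoothVectorField 𝓘(ℝ, E) U) (p : U) :
    D.curvature X Y Z p = -D.curvature Y X Z p := by
  have hb : D.toFun (X.bracket Y) Z p = -D.toFun (Y.bracket X) Z p := by
    have : D.toFun (X.bracket Y) Z p + D.toFun (Y.bracket X) Z p
        = D.toFun (X.bracket Y + Y.bracket X) Z p := by rw [D.add_left]; rfl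
    have h0 : D.toFun (X.bracket Y + Y.bracket X) Z p
        = D.toFun (SmoothVectorField.fsmul (smoothFun (fun _ => 0) fun _ => contDiffAt_const) X)
          Z p := by
      refine D.apply_congr_left Z ?_
      change X.bracket Y p + Y.bracket X p = (0 : ℝ) • X p
      rw [hD.bracket_apply, hD.bracket_apply]
      module
    rw [D.smul_left] at h0
    have h1 : D.toFun (X.bracket Y + Y.bracket X) Z p = 0 := h0.trans (zero_smul ℝ _)
    exact eq_neg_of_add_eq_zero_left (this.trans h1)
  rw [curvature_apply, curvature_apply, hb]
  abel

/-- A torsion-free connection on a one-dimensional space is flat. -/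
lemma IsTorsionFree.isFlat_of_forall_smul {D : AffineConnection 𝓘(ℝ, E) U} (hD : D.IsTorsionFree)
    (e : E) (he : ∀ v : E, ∃ a : ℝ, v = a • e) : D.IsFlat := by
  intro X Y Z
  ext p
  change D.curvature X Y Z p = 0
  obtain ⟨a, ha⟩ := he (X p)
  obtain ⟨b, hb⟩ := he (Y p)
  let W : SmoothVectorField 𝓘(ℝ, E) U :=
    SmoothVectorField.ofFun (fun _ => e) fun _ => contDiffAt_const
  have hX : X p = a • W p := ha
  have hY : Y p = b • W p := hb
  have h0 : D.curvature W W Z p = 0 := by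
    have h1 := hD.curvature_swap W W Z p
    have h2 : (2 : ℝ) • D.curvature W W Z p = 0 := by
      rw [two_smul]; nth_rewrite 1 [h1]; exact neg_add_cancel _
    exact (smul_eq_zero.1 h2).resolve_left two_ne_zero
  rw [hD.curvature_eq_smul Y Z hX, hD.curvature_swap, hD.curvature_eq_smul W Z hY, h0]
  module

end AffineConnection

end Tensoriality

section GaussianConnection

attribute [local instance] Matrix.linftyOpNormedRing Matrix.linftyOpNormedAlgebra

open SymMatrix SmoothVectorField OpenSubset

variable {n : ℕ}

/-- The metric `tr(S⁻¹ X S⁻¹ Y) / 2` on positive definite matrices. -/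
noncomputable def traceMetric (n : ℕ) :
    SmoothRiemannianMetric (gaussModel n) (centeredGaussians n) :=
  OpenSubset.metric traceForm (fun p => contDiffAt_traceForm p.2)
    (fun p => traceForm_symm p.1) (fun p => traceForm_pos p.2)

/-- The covariant derivative `dY(X) - (X S⁻¹ Y + Y S⁻¹ X) / 2` on vector-valued functions. -/
noncomputable def traceCovDeriv (V W : SymMatrix n → SymMatrix n) (S : SymMatrix n) :
    SymMatrix n :=
  fderiv ℝ W S (V S) - symPart (mat (V S) * (mat S)⁻¹ * mat (W S))

lemma contDiffAt_traceCovDeriv {V W : SymMatrix n → SymMatrix n} {S : SymMatrix n}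
    (hS : (mat S).PosDef) (hV : ContDiffAt ℝ ∞ V S) (hW : ContDiffAt ℝ ∞ W S) :
    ContDiffAt ℝ ∞ (traceCovDeriv V W) S := by
  refine ((hW.fderiv_right (m := ∞) le_rfl).clm_apply hV).sub ?_
  exact symPart.contDiff.contDiffAt.comp S
    (((matL.contDiff.contDiffAt.comp S hV).mul (contDiffAt_inv hS)).mul
      (matL.contDiff.contDiffAt.comp S hW))

/-- The Levi-Civita connection of `traceMetric`. -/
noncomputable def traceConnection (n : ℕ) :
    AffineConnection (gaussModel n) (centeredGaussians n) where
  toFun X Y := ofFun (traceCovDeriv X.toVec Y.toVec) fun p =>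
    contDiffAt_traceCovDeriv p.2 (X.contDiffAt_toVec p) (Y.contDiffAt_toVec p)
  add_left X X' Y := by
    ext p
    change traceCovDeriv _ _ p.1 = traceCovDeriv _ _ p.1 + traceCovDeriv _ _ p.1
    have h : (X + X').toVec p.1 = X.toVec p.1 + X'.toVec p.1 := by
      rw [toVec_apply, toVec_apply, toVec_apply]; rfl
    simp only [traceCovDeriv, h, map_add, add_mul]
    abel
  smul_left f X Y := by
    ext p
    change traceCovDeriv _ _ p.1 = f p • traceCovDeriv _ _ p.1
    have h : (fsmul f X).toVec p.1 = f p • X.toVec p.1 := by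
      rw [toVec_apply, toVec_apply]; rfl
    simp only [traceCovDeriv, h, map_smul, Matrix.smul_mul, smul_sub]
  add_right X Y Y' := by
    ext p
    change traceCovDeriv _ _ p.1 = traceCovDeriv _ _ p.1 + traceCovDeriv _ _ p.1
    have h := eventually_toVec_eq (X := Y + Y') (V := Y.toVec + Y'.toVec) (fun q => by
      rw [Pi.add_apply, toVec_apply, toVec_apply]; rfl) p
    have hd : fderiv ℝ (Y.toVec + Y'.toVec) p.1 = fderiv ℝ Y.toVec p.1 + fderiv ℝ Y'.toVec p.1 :=
      fderiv_add (Y.differentiableAt_toVec p) (Y'.differentiableAt_toVec p)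
    simp only [traceCovDeriv, h.eq_of_nhds, h.fderiv_eq, hd, Pi.add_apply, add_apply, map_add,
      mul_add]
    abel
  leibniz f X Y p := by
    change traceCovDeriv _ _ p.1 = f p • traceCovDeriv _ _ p.1 + _
    have hf : DifferentiableAt ℝ (Subtype.val.extend f 0) p.1 :=
      (contDiffAt_extend (f.contMDiff p)).differentiableAt (by simp)
    have h := eventually_toVec_eq (X := fsmul f Y)
      (V := fun x => Subtype.val.extend f 0 x • Y.toVec x) (fun q => by
        rw [extend_apply, toVec_apply]; rfl) p
    have hX : X.deriv f p = fderiv ℝ (Subtype.val.extend f 0) p.1 (X p) := by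
      rw [← deriv_eq X hf.hasFDerivAt]
      congr 1
      funext q
      exact (extend_apply f q).symm
    have hd := (hf.hasFDerivAt.smul (Y.differentiableAt_toVec p).hasFDerivAt).fderiv
    rw [hX, ← X.toVec_apply, ← Y.toVec_apply]
    have hm : mat (Subtype.val.extend f 0 p.1 • Y.toVec p.1) = f p • mat (Y.toVec p.1) := by
      rw [extend_apply, map_smul]
    simp only [traceCovDeriv, h.eq_of_nhds, h.fderiv_eq, hm, Matrix.mul_smul, map_smul]
    refine (congrArg (fun L => L (X.toVec p.1) - _) hd).trans ?_
    change (Subtype.val.extend f 0 p.1 • fderiv ℝ Y.toVec p.1 (X.toVec p.1)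
      + fderiv ℝ (Subtype.val.extend f 0) p.1 (X.toVec p.1) • Y.toVec p.1) - _ = _
    rw [extend_apply, smul_sub]
    exact add_sub_right_comm _ _ _

lemma traceConnection_isTorsionFree : (traceConnection n).IsTorsionFree := by
  intro X Y
  ext p
  rw [bracket_eq, ← X.toVec_apply, ← Y.toVec_apply]
  change traceCovDeriv _ _ p.1 - traceCovDeriv _ _ p.1 = _
  rw [traceCovDeriv, traceCovDeriv, symPart_swap]
  abel

lemma traceConnection_isLeviCivita : (traceConnection n).IsLeviCivita (traceMetric n) := by
  refine ⟨traceConnection_isTorsionFree, fun X Y Z p => ?_⟩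
  obtain ⟨L, hL, hLV⟩ := hasFDerivAt_traceForm p.2 (Y.differentiableAt_toVec p)
    (Z.differentiableAt_toVec p)
  have hX : X.deriv (fun q => (traceMetric n).inner q (Y q) (Z q)) p = L (X.toVec p.1) := by
    rw [toVec_apply, ← deriv_eq X hL]
    congr 1
    funext q
    rw [toVec_apply, toVec_apply]; rfl
  have hY : (traceMetric n).inner p ((traceConnection n).toFun X Y p) (Z p) =
      traceForm p.1 (traceCovDeriv X.toVec Y.toVec p.1) (Z.toVec p.1) := by
    rw [toVec_apply]; rfl
  have hZ : (traceMetric n).inner p (Y p) ((traceConnection n).toFun X Z p) =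
      traceForm p.1 (Y.toVec p.1) (traceCovDeriv X.toVec Z.toVec p.1) := by
    rw [toVec_apply]; rfl
  rw [AffineConnection.nablaMetric, hX, hLV, hY, hZ]
  simp only [traceCovDeriv, map_sub, sub_apply]
  ring

/-- The map `T ↦ S T⁻¹ S` on symmetric matrices. -/
noncomputable def geodesicReflection (S T : SymMatrix n) : SymMatrix n :=
  symPart (mat S * (mat T)⁻¹ * mat S)

lemma mat_geodesicReflection (S T : SymMatrix n) :
    mat (geodesicReflection S T) = mat S * (mat T)⁻¹ * mat S := by
  rw [geodesicReflection, mat_symPart]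
  simp only [Matrix.transpose_mul, mat_transpose, transpose_inv, ← Matrix.mul_assoc]
  module

lemma geodesicReflection_posDef {S T : SymMatrix n} (hS : (mat S).PosDef) (hT : (mat T).PosDef) :
    (mat (geodesicReflection S T)).PosDef := by
  rw [mat_geodesicReflection]
  have h := hT.inv.conjTranspose_mul_mul_same (B := mat S)
    (Matrix.mulVec_injective_of_isUnit hS.isUnit)
  rwa [Matrix.conjTranspose_eq_transpose_of_trivial, mat_transpose] at h

lemma geodesicReflection_involutive {S T : SymMatrix n} (hS : (mat S).PosDef)
    (hT : (mat T).PosDef) : geodesicReflection S (geodesicReflection S T) = T := by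
  apply mat_injective
  have hs := isUnit_det hS
  have ht := isUnit_det hT
  rw [mat_geodesicReflection, mat_geodesicReflection, Matrix.mul_inv_rev, Matrix.mul_inv_rev,
    Matrix.nonsing_inv_nonsing_inv _ ht]
  rw [← Matrix.mul_assoc, Matrix.mul_nonsing_inv _ hs, Matrix.one_mul, Matrix.mul_assoc,
    Matrix.nonsing_inv_mul _ hs, Matrix.mul_one]

lemma contDiffAt_geodesicReflection (S : SymMatrix n) {T : SymMatrix n} (hT : (mat T).PosDef) :
    ContDiffAt ℝ ∞ (geodesicReflection S) T :=
  symPart.contDiff.contDiffAt.comp T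
    ((contDiffAt_const.mul (contDiffAt_inv hT)).mul contDiffAt_const)

lemma fderiv_geodesicReflection (S : SymMatrix n) {T : SymMatrix n} (hT : (mat T).PosDef)
    (V : SymMatrix n) : mat (fderiv ℝ (geodesicReflection S) T V) =
      -(mat S * ((mat T)⁻¹ * mat V * (mat T)⁻¹) * mat S) := by
  have h := symPart.hasFDerivAt.comp T
    (((hasFDerivAt_inv hT).const_mul (mat S)).mul_const' (mat S))
  have e : mat (fderiv ℝ (geodesicReflection S) T V) =
      mat (symPart (mat S * -((mat T)⁻¹ * mat V * (mat T)⁻¹) * mat S)) := by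
    congr 1
    exact congrArg (fun L => L V) h.fderiv
  rw [e, mat_symPart]
  simp only [Matrix.transpose_mul, Matrix.transpose_neg, mat_transpose, transpose_inv, mul_neg,
    neg_mul, ← Matrix.mul_assoc]
  module

/-- The geodesic symmetry at `S` as a diffeomorphism. -/
noncomputable def geodesicSymmetry (S : centeredGaussians n) :
    centeredGaussians n ≃ₘ⟮gaussModel n, gaussModel n⟯ centeredGaussians n where
  toFun T := ⟨geodesicReflection S.1 T.1, geodesicReflection_posDef S.2 T.2⟩
  invFun T := ⟨geodesicReflection S.1 T.1, geodesicReflection_posDef S.2 T.2⟩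
  left_inv T := Subtype.ext (geodesicReflection_involutive S.2 T.2)
  right_inv T := Subtype.ext (geodesicReflection_involutive S.2 T.2)
  contMDiff_toFun := contMDiff_of_val_eq (f := geodesicReflection S.1) (fun _ => rfl)
    fun p => contDiffAt_geodesicReflection S.1 p.2
  contMDiff_invFun := contMDiff_of_val_eq (f := geodesicReflection S.1) (fun _ => rfl)
    fun p => contDiffAt_geodesicReflection S.1 p.2

lemma geodesicSymmetry_val (S T : centeredGaussians n) :
    (geodesicSymmetry S T).1 = geodesicReflection S.1 T.1 := rfl

lemma mat_mfderiv_geodesicSymmetry (S T : centeredGaussians n)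
    (v : TangentSpace (gaussModel n) T) :
    mat (mfderiv (gaussModel n) (gaussModel n) (geodesicSymmetry S) T v) =
      -(mat S.1 * ((mat T.1)⁻¹ * mat (v : SymMatrix n) * (mat T.1)⁻¹) * mat S.1) := by
  refine Eq.trans ?_ (fderiv_geodesicReflection S.1 T.2 v)
  exact congrArg mat (mfderiv_of_val_eq (f := geodesicReflection S.1) (fun _ => rfl)
    ((geodesicSymmetry S).contMDiff.mdifferentiableAt (by simp))
    ((contDiffAt_geodesicReflection S.1 T.2).differentiableAt (by simp)).hasFDerivAt v)

lemma geodesicSymmetry_apply_self (S : centeredGaussians n) : geodesicSymmetry S S = S := by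
  apply Subtype.ext
  apply mat_injective
  rw [geodesicSymmetry_val, mat_geodesicReflection, Matrix.mul_nonsing_inv _ (isUnit_det S.2),
    Matrix.one_mul]

lemma mfderiv_geodesicSymmetry_self (S : centeredGaussians n)
    (v : TangentSpace (gaussModel n) S) :
    (mfderiv (gaussModel n) (gaussModel n) (geodesicSymmetry S) S v : SymMatrix n)
      = -(v : SymMatrix n) := by
  apply mat_injective
  refine (mat_mfderiv_geodesicSymmetry S S v).trans ?_
  have hs := isUnit_det S.2
  have e : ∀ A : SymMatrix n,
      -(mat S.1 * ((mat S.1)⁻¹ * mat A * (mat S.1)⁻¹) * mat S.1) = mat (-A) := by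
    intro A
    rw [map_neg, ← Matrix.mul_assoc, ← Matrix.mul_assoc, Matrix.mul_nonsing_inv _ hs,
      Matrix.one_mul, Matrix.mul_assoc, Matrix.nonsing_inv_mul _ hs, Matrix.mul_one]
  exact e v

lemma traceForm_geodesicReflection {S T : SymMatrix n} (hS : (mat S).PosDef)
    (hT : (mat T).PosDef) {A B A' B' : SymMatrix n}
    (hA : mat A' = -(mat S * ((mat T)⁻¹ * mat A * (mat T)⁻¹) * mat S))
    (hB : mat B' = -(mat S * ((mat T)⁻¹ * mat B * (mat T)⁻¹) * mat S)) :
    traceForm (geodesicReflection S T) A' B' = traceForm T A B := by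
  have hs := isUnit_det hS
  have ht := isUnit_det hT
  rw [traceForm_apply, traceForm_apply, hA, hB, mat_geodesicReflection, Matrix.mul_inv_rev,
    Matrix.mul_inv_rev, Matrix.nonsing_inv_nonsing_inv _ ht]
  have c1 : ∀ A : Matrix (Fin n) (Fin n) ℝ, (mat S)⁻¹ * (mat S * A) = A := fun A => by
    rw [← Matrix.mul_assoc, Matrix.nonsing_inv_mul _ hs, Matrix.one_mul]
  have c2 : ∀ A : Matrix (Fin n) (Fin n) ℝ, mat S * ((mat S)⁻¹ * A) = A := fun A => by
    rw [← Matrix.mul_assoc, Matrix.mul_nonsing_inv _ hs, Matrix.one_mul]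
  have c3 : ∀ A : Matrix (Fin n) (Fin n) ℝ, mat T * ((mat T)⁻¹ * A) = A := fun A => by
    rw [← Matrix.mul_assoc, Matrix.mul_nonsing_inv _ ht, Matrix.one_mul]
  congr 1
  simp only [mul_neg, neg_mul, neg_neg, Matrix.mul_assoc, c1, c2, c3]
  rw [Matrix.trace_mul_comm]
  simp only [Matrix.mul_assoc]
  rw [Matrix.mul_nonsing_inv _ hs, Matrix.mul_one, Matrix.trace_mul_comm (mat T)⁻¹]
  simp only [Matrix.mul_assoc]

lemma geodesicSymmetry_preservesMetric (S : centeredGaussians n) :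
    PreservesMetric (traceMetric n) (geodesicSymmetry S) := fun T v w =>
  traceForm_geodesicReflection S.2 T.2 (mat_mfderiv_geodesicSymmetry S T v)
    (mat_mfderiv_geodesicSymmetry S T w)

/-- A connection invariant under all isometries is the Levi-Civita connection. -/
lemma eq_traceConnection_of_invariant (D : AffineConnection (gaussModel n) (centeredGaussians n))
    (h : ∀ f : centeredGaussians n ≃ₘ⟮gaussModel n, gaussModel n⟯ centeredGaussians n,
      PreservesMetric (traceMetric n) f → IsAffineMap f D D) : D = traceConnection n := by
  ext X Y S : 4
  have hp := geodesicSymmetry_preservesMetric S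
  have h1 := h _ hp _ _ _ _ (X.related_push _) (Y.related_push _) S
  have h2 := traceConnection_isLeviCivita.isAffineMap exists_apply_eq hp _ _ _ _
    (X.related_push _) (Y.related_push _) S
  have cast : ∀ Z : SmoothVectorField (gaussModel n) (centeredGaussians n),
      (Z (geodesicSymmetry S S) : SymMatrix n) = Z S := by
    have : ∀ r, r = S → ∀ Z : SmoothVectorField (gaussModel n) (centeredGaussians n),
      (Z r : SymMatrix n) = Z S := by rintro _ rfl _; rfl
    exact this _ (geodesicSymmetry_apply_self S)
  have hpush : ∀ Z : SmoothVectorField (gaussModel n) (centeredGaussians n),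
      Z.push (geodesicSymmetry S) S = (-Z) S := fun Z =>
    ((cast _).symm.trans (Z.related_push (geodesicSymmetry S) S).symm).trans
      (mfderiv_geodesicSymmetry_self S (Z S))
  have h3 := (mfderiv_geodesicSymmetry_self S _).symm.trans (h1.trans (cast _))
  have h4 := (mfderiv_geodesicSymmetry_self S _).symm.trans (h2.trans (cast _))
  have h5 := AffineConnection.sub_congr (traceConnection n) D (hpush X) (hpush Y)
  rw [AffineConnection.sub_neg_neg] at h5
  have h6 : (-(D.toFun X Y S) - -((traceConnection n).toFun X Y S) : SymMatrix n)
    = D.toFun X Y S - (traceConnection n).toFun X Y S :=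
    (congrArg₂ (fun a b : SymMatrix n => a - b) h3 h4).trans h5
  have h7 : (2 : ℝ) • (D.toFun X Y S - (traceConnection n).toFun X Y S : SymMatrix n) = 0 := by
    rw [two_smul]
    nth_rewrite 1 [← h6]
    abel
  exact sub_eq_zero.1 ((smul_eq_zero.1 h7).resolve_left two_ne_zero)

end GaussianConnection

section GaussianCurvature

attribute [local instance] Matrix.linftyOpNormedRing Matrix.linftyOpNormedAlgebra

open SymMatrix SmoothVectorField OpenSubset

variable {n : ℕ}

/-- The constant vector field with value `A`. -/
noncomputable def constField (A : SymMatrix n) :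
    SmoothVectorField (gaussModel n) (centeredGaussians n) :=
  ofFun (fun _ => A) fun _ => contDiffAt_const

lemma constField_toVec (A : SymMatrix n) (p : centeredGaussians n) :
    (constField A).toVec =ᶠ[𝓝 p.1] fun _ => A :=
  eventually_toVec_eq (fun _ => rfl) p

lemma traceConnection_constField (A B : SymMatrix n) (p : centeredGaussians n) :
    ((traceConnection n).toFun (constField A) (constField B)).toVec =ᶠ[𝓝 p.1]
      fun T => -symPart (mat A * (mat T)⁻¹ * mat B) := by
  refine eventually_toVec_eq (fun q => ?_) p
  change traceCovDeriv _ _ q.1 = _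
  have hA := (constField_toVec A q).eq_of_nhds
  have hB := (constField_toVec B q).eq_of_nhds
  have hB' : fderiv ℝ (constField B).toVec q.1 = 0 := by
    rw [(constField_toVec B q).fderiv_eq, fderiv_const_apply]
  simp only [traceCovDeriv, hA, hB, hB']
  simp

lemma traceConnection_constField_constField (A B C : SymMatrix n) (p : centeredGaussians n)
    (hp : mat p.1 = 1) :
    (traceConnection n).toFun (constField A) ((traceConnection n).toFun (constField B)
      (constField C)) p =
      symPart (mat B * mat A * mat C) + symPart (mat A * mat (symPart (mat B * mat C))) := by
  change traceCovDeriv _ _ p.1 = _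
  have hA := (constField_toVec A p).eq_of_nhds
  have hBC := traceConnection_constField B C p
  have hd := (symPart.hasFDerivAt.comp p.1
    (((hasFDerivAt_inv p.2).const_mul (mat B)).mul_const' (mat C))).neg
  have hd' : fderiv ℝ (fun T => -symPart (mat B * (mat T)⁻¹ * mat C)) p.1 A
      = -symPart (mat B * -((mat p.1)⁻¹ * mat A * (mat p.1)⁻¹) * mat C) :=
    congrArg (fun L => L A) hd.fderiv
  rw [traceCovDeriv, hA, hBC.fderiv_eq, hBC.eq_of_nhds, hd', hp]
  simp [sub_eq_add_neg]

lemma traceConnection_curvature_constField (A B C : SymMatrix n) (p : centeredGaussians n)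
    (hp : mat p.1 = 1) :
    (traceConnection n).curvature (constField A) (constField B) (constField C) p =
      (symPart (mat B * mat A * mat C) + symPart (mat A * mat (symPart (mat B * mat C))))
      - (symPart (mat A * mat B * mat C) + symPart (mat B * mat (symPart (mat A * mat C)))) := by
  have hb : (traceConnection n).toFun ((constField A).bracket (constField B)) (constField C) p
      = 0 := by
    have h0 : ((constField A).bracket (constField B)).toVec p.1 = 0 := by
      rw [toVec_apply, bracket_eq, (constField_toVec A p).fderiv_eq,
        (constField_toVec B p).fderiv_eq, fderiv_const_apply, fderiv_const_apply]
      exact sub_self (0 : SymMatrix n)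
    change traceCovDeriv _ _ p.1 = 0
    rw [traceCovDeriv, h0]
    simp
  rw [AffineConnection.curvature_apply, hb, traceConnection_constField_constField _ _ _ p hp,
    traceConnection_constField_constField _ _ _ p hp]
  exact sub_zero _

lemma traceConnection_not_isFlat (hn : 2 ≤ n) : ¬(traceConnection n).IsFlat := by
  intro h
  let i : Fin n := ⟨0, by omega⟩
  let j : Fin n := ⟨1, by omega⟩
  have hij : i ≠ j := by simp [i, j, Fin.ext_iff]
  let A : SymMatrix n := ofSymm (Matrix.single i i 1) (by simp)
  let B : SymMatrix n := ofSymm (Matrix.single i j 1 + Matrix.single j i 1) (by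
    simp [add_comm])
  let p : centeredGaussians n := ⟨ofSymm 1 Matrix.transpose_one, by
    change (1 : Matrix (Fin n) (Fin n) ℝ).PosDef
    exact Matrix.PosDef.one⟩
  have h1 := traceConnection_curvature_constField A B A p rfl
  rw [h] at h1
  have h2 := congrArg (fun X => mat X i j) h1
  have hA : mat A = Matrix.single i i 1 := rfl
  have hB : mat B = Matrix.single i j 1 + Matrix.single j i 1 := rfl
  have h3 : mat (((0 : SmoothVectorField (gaussModel n) (centeredGaussians n)) p : SymMatrix n))
    i j = 0 := rfl
  rw [h3] at h2
  simp [mat_symPart, hA, hB, add_mul, mul_add, hij, hij.symm] at h2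
  norm_num at h2

lemma traceConnection_isFlat_one : (traceConnection 1).IsFlat := by
  refine traceConnection_isTorsionFree.isFlat_of_forall_smul (ofSymm 1 Matrix.transpose_one)
    fun v => ⟨mat v 0 0, mat_injective ?_⟩
  ext i j
  rw [map_smul, mat_ofSymm, Subsingleton.elim i 0, Subsingleton.elim j 0]
  simp

end GaussianCurvature

section GaussianMoments

/-- The standard normal density. -/
noncomputable def normalDensity (t : ℝ) : ℝ := (√(2 * Real.pi))⁻¹ * Real.exp (-(1 / 2) * t ^ 2)

lemma integrable_pow_mul_normalDensity (k : ℕ) :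
    Integrable fun t : ℝ => t ^ k * normalDensity t := by
  have h := integrable_rpow_mul_exp_neg_mul_sq (b := 1 / 2) (by norm_num) (s := k)
    (by have : (0 : ℝ) ≤ k := k.cast_nonneg
        linarith)
  simp only [Real.rpow_natCast] at h
  refine (h.const_mul (√(2 * Real.pi))⁻¹).congr (Filter.Eventually.of_forall fun t => ?_)
  simp only [normalDensity]
  ring

/-- The moments of the standard normal distribution. -/
noncomputable def normalMoment (k : ℕ) : ℝ := ∫ t : ℝ, t ^ k * normalDensity t

lemma normalMoment_odd {k : ℕ} (hk : Odd k) : normalMoment k = 0 := by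
  have h := integral_neg_eq_self (fun t : ℝ => t ^ k * normalDensity t) volume
  have e : ∀ t : ℝ, (-t) ^ k * normalDensity (-t) = -(t ^ k * normalDensity t) := by
    intro t
    rw [hk.neg_pow, normalDensity, neg_sq, ← normalDensity, neg_mul]
  simp only [e, integral_neg] at h
  rw [normalMoment]
  linarith

lemma normalMoment_even (k : ℕ) :
    normalMoment (2 * k) = 2 ^ k * Real.Gamma (k + 1 / 2) / √Real.pi := by
  have h := integral_comp_abs (f := fun t : ℝ => t ^ (2 * k) * Real.exp (-(1 / 2) * t ^ 2))
  have h2 := integral_rpow_mul_exp_neg_mul_rpow (p := 2) (q := ((2 * k : ℕ) : ℝ)) (b := 1 / 2)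
    (by norm_num) (by have : (0 : ℝ) ≤ ((2 * k : ℕ) : ℝ) := Nat.cast_nonneg _
                      linarith) (by norm_num)
  simp only [Real.rpow_natCast, Real.rpow_two] at h2
  rw [h2] at h
  have e : ∀ t : ℝ, |t| ^ (2 * k) * Real.exp (-(1 / 2) * |t| ^ 2)
      = t ^ (2 * k) * Real.exp (-(1 / 2) * t ^ 2) := by
    intro t
    rw [sq_abs, pow_mul, sq_abs, ← pow_mul]
  simp only [e] at h
  have e2 : (((2 * k : ℕ) : ℝ) + 1) / 2 = k + 1 / 2 := by push_cast; ring
  have e3 : (1 / 2 : ℝ) ^ (-(((2 * k : ℕ) : ℝ) + 1) / 2) = √2 * 2 ^ k := by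
    rw [neg_div, e2, one_div, Real.inv_rpow zero_le_two, ← Real.rpow_neg zero_le_two, neg_neg,
      Real.rpow_add two_pos, Real.rpow_natCast, Real.sqrt_eq_rpow, mul_comm, one_div]
  rw [e2, e3] at h
  have h3 : normalMoment (2 * k) =
      (√(2 * Real.pi))⁻¹ * ∫ t : ℝ, t ^ (2 * k) * Real.exp (-(1 / 2) * t ^ 2) := by
    rw [normalMoment, ← integral_const_mul]
    congr 1
    funext t
    simp only [normalDensity]
    ring
  rw [h3, h, Real.sqrt_mul zero_le_two]
  have : √Real.pi ≠ 0 := (Real.sqrt_pos.2 Real.pi_pos).ne'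
  field_simp

lemma normalMoment_zero : normalMoment 0 = 1 := by
  have h := normalMoment_even 0
  have : √Real.pi ≠ 0 := (Real.sqrt_pos.2 Real.pi_pos).ne'
  rw [mul_zero, Nat.cast_zero, zero_add, Real.Gamma_one_half_eq] at h
  rw [h]
  field_simp

lemma normalMoment_two : normalMoment 2 = 1 := by
  have h := normalMoment_even 1
  have : √Real.pi ≠ 0 := (Real.sqrt_pos.2 Real.pi_pos).ne'
  rw [Nat.cast_one, add_comm, Real.Gamma_add_one (by norm_num), Real.Gamma_one_half_eq] at h
  rw [h]
  field_simp

lemma normalMoment_four : normalMoment 4 = 3 := by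
  have h := normalMoment_even 2
  have : √Real.pi ≠ 0 := (Real.sqrt_pos.2 Real.pi_pos).ne'
  rw [show ((2 : ℕ) : ℝ) + 1 / 2 = 1 / 2 + 1 + 1 by norm_num, Real.Gamma_add_one (by norm_num),
    Real.Gamma_add_one (by norm_num), Real.Gamma_one_half_eq] at h
  rw [h]
  field_simp
  norm_num

variable {n : ℕ}

lemma prod_normalMoment_pair (i j : Fin n) :
    ∏ m, normalMoment ((Pi.single i 1 + Pi.single j 1 : Fin n → ℕ) m) = if i = j then 1 else 0 := by
  by_cases hij : i = j
  · subst hij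
    rw [if_pos rfl]
    refine Finset.prod_eq_one fun m _ => ?_
    by_cases hm : m = i
    · subst hm; simp [normalMoment_two]
    · simp [hm, normalMoment_zero]
  · rw [if_neg hij]
    refine Finset.prod_eq_zero (Finset.mem_univ i) ?_
    simp [hij, normalMoment_odd odd_one]

/-- Wick's formula for fourth moments. -/
lemma prod_normalMoment_quad (i j k l : Fin n) :
    ∏ m, normalMoment ((Pi.single i 1 + Pi.single j 1 + Pi.single k 1 + Pi.single l 1 :
        Fin n → ℕ) m) =
      (if i = j then 1 else 0) * (if k = l then 1 else 0)
      + (if i = k then 1 else 0) * (if j = l then 1 else 0)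
      + (if i = l then 1 else 0) * (if j = k then 1 else 0) := by
  have pair : ∀ a b : Fin n, a ≠ b → ∀ m, normalMoment
      ((if m = a then 2 else 0) + (if m = b then 2 else 0)) = 1 := by
    intro a b hab m
    by_cases ha : m = a
    · subst ha; simp [hab, normalMoment_two]
    · by_cases hb : m = b
      · subst hb; simp [ha, normalMoment_two]
      · simp [ha, hb, normalMoment_zero]
  have odd : ∀ (c : Fin n → ℕ) (a : Fin n), c a = 1 → ∏ m, normalMoment (c m) = 0 :=
    fun c a ha => Finset.prod_eq_zero (Finset.mem_univ a) (by
      rw [ha, normalMoment_odd odd_one])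
  by_cases hij : i = j
  · subst hij
    by_cases hkl : k = l
    · subst hkl
      by_cases hik : i = k
      · subst hik
        rw [Finset.prod_eq_single i]
        · simp [normalMoment_four]; norm_num
        · intro m _ hm; simp [hm, normalMoment_zero]
        · simp
      · rw [Finset.prod_eq_one]
        · simp [hik]
        · intro m _
          rw [← pair i k hik m]
          congr 1
          simp only [Pi.add_apply, Pi.single_apply]
          split_ifs <;> rfl
    · by_cases hki : k = i
      · subst hki
        rw [odd _ l (by simp [Ne.symm hkl])]
        simp [hkl]
      · rw [odd _ k (by simp [hkl, hki])]
        simp [hkl, Ne.symm hki]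
  · by_cases hki : k = i
    · subst hki
      by_cases hlj : l = j
      · subst hlj
        rw [Finset.prod_eq_one]
        · simp [hij]
        · intro m _
          rw [← pair k l hij m]
          congr 1
          simp only [Pi.add_apply, Pi.single_apply]
          split_ifs <;> rfl
      · rw [odd _ j (by simp [Ne.symm hij, Ne.symm hlj])]
        simp [hij, Ne.symm hlj, Ne.symm hij]
    · by_cases hli : l = i
      · subst hli
        by_cases hkj : k = j
        · subst hkj
          rw [Finset.prod_eq_one]
          · simp [hij]
          · intro m _
            rw [← pair k l hki m]
            congr 1
            simp only [Pi.add_apply, Pi.single_apply]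
            split_ifs <;> rfl
        · rw [odd _ k (by simp [hkj, hki])]
          simp [hij, Ne.symm hkj, Ne.symm hki]
      · rw [odd _ i (by simp [hij, Ne.symm hki, Ne.symm hli])]
        simp [hij, Ne.symm hki, Ne.symm hli]

/-- The standard normal density on `ℝⁿ`. -/
noncomputable def stdNormalDensity (z : Fin n → ℝ) : ℝ := ∏ m, normalDensity (z m)

lemma integrable_monomial_mul (c : Fin n → ℕ) :
    Integrable fun z : Fin n → ℝ => (∏ m, z m ^ c m) * stdNormalDensity z := by
  simp only [stdNormalDensity, ← Finset.prod_mul_distrib]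
  exact Integrable.fintype_prod (f := fun m t => t ^ c m * normalDensity t)
    fun m => integrable_pow_mul_normalDensity (c m)

lemma integral_monomial_mul (c : Fin n → ℕ) :
    ∫ z : Fin n → ℝ, (∏ m, z m ^ c m) * stdNormalDensity z = ∏ m, normalMoment (c m) := by
  simp only [stdNormalDensity, ← Finset.prod_mul_distrib]
  exact integral_fintype_prod_volume_eq_prod (fun m t => t ^ c m * normalDensity t)

lemma prod_pow_single (z : Fin n → ℝ) (i : Fin n) :
    ∏ m, z m ^ (Pi.single i 1 : Fin n → ℕ) m = z i := by
  rw [Finset.prod_eq_single i]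
  · simp
  · intro m _ hm; simp [hm]
  · simp

lemma prod_pow_pair (z : Fin n → ℝ) (i j : Fin n) :
    ∏ m, z m ^ (Pi.single i 1 + Pi.single j 1 : Fin n → ℕ) m = z i * z j := by
  simp only [Pi.add_apply, pow_add, Finset.prod_mul_distrib, prod_pow_single]

lemma prod_pow_quad (z : Fin n → ℝ) (i j k l : Fin n) :
    ∏ m, z m ^ (Pi.single i 1 + Pi.single j 1 + Pi.single k 1 + Pi.single l 1 : Fin n → ℕ) m
      = z i * z j * z k * z l := by
  simp only [Pi.add_apply, pow_add, Finset.prod_mul_distrib, prod_pow_single]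

/-- The covariance of two products of coordinates under the standard normal distribution. -/
lemma integral_wick (i j k l : Fin n) :
    Integrable (fun z : Fin n → ℝ => (z i * z j - if i = j then 1 else 0) *
      (z k * z l - if k = l then 1 else 0) * stdNormalDensity z) ∧
    ∫ z : Fin n → ℝ, (z i * z j - if i = j then 1 else 0) *
      (z k * z l - if k = l then 1 else 0) * stdNormalDensity z =
      (if i = k then 1 else 0) * (if j = l then 1 else 0)
      + (if i = l then 1 else 0) * (if j = k then 1 else 0) := by
  set a : ℝ := if i = j then 1 else 0
  set b : ℝ := if k = l then 1 else 0
  have i4 := integrable_monomial_mul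
    (Pi.single i 1 + Pi.single j 1 + Pi.single k 1 + Pi.single l 1 : Fin n → ℕ)
  have i2 := integrable_monomial_mul (Pi.single i 1 + Pi.single j 1 : Fin n → ℕ)
  have i2' := integrable_monomial_mul (Pi.single k 1 + Pi.single l 1 : Fin n → ℕ)
  have i0 := integrable_monomial_mul (0 : Fin n → ℕ)
  have h4 := integral_monomial_mul
    (Pi.single i 1 + Pi.single j 1 + Pi.single k 1 + Pi.single l 1 : Fin n → ℕ)
  have h2 := integral_monomial_mul (Pi.single i 1 + Pi.single j 1 : Fin n → ℕ)
  have h2' := integral_monomial_mul (Pi.single k 1 + Pi.single l 1 : Fin n → ℕ)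
  have h0 := integral_monomial_mul (0 : Fin n → ℕ)
  rw [prod_normalMoment_quad] at h4
  rw [prod_normalMoment_pair] at h2 h2'
  simp only [prod_pow_quad] at i4 h4
  simp only [prod_pow_pair] at i2 h2 i2' h2'
  simp only [Pi.zero_apply, pow_zero, Finset.prod_const_one, one_mul, normalMoment_zero] at i0 h0
  have e : (fun z : Fin n → ℝ => (z i * z j - a) * (z k * z l - b) * stdNormalDensity z) =
      fun z => ((z i * z j * z k * z l * stdNormalDensity z
        - b * (z i * z j * stdNormalDensity z)) - a * (z k * z l * stdNormalDensity z))
        + a * b * stdNormalDensity z := by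
    funext z; ring
  rw [e]
  have j2 := i2.const_mul b
  have j2' := i2'.const_mul a
  have j0 := i0.const_mul (a * b)
  have j42 := i4.sub j2
  have j422 := j42.sub j2'
  refine ⟨j422.add j0, ?_⟩
  refine (integral_add j422 j0).trans ?_
  refine (congrArg₂ (· + ·) ((integral_sub j42 j2').trans
    (congrArg₂ (· - ·) (integral_sub i4 j2) rfl)) rfl).trans ?_
  rw [integral_const_mul, integral_const_mul, integral_const_mul, h4, h2, h2', h0]
  ring

/-- The covariance of two quadratic forms under the standard normal distribution. -/
lemma integral_quadratic_mul_quadratic (A C : Matrix (Fin n) (Fin n) ℝ) (hC : Cᵀ = C) :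
    ∫ z : Fin n → ℝ, (z ⬝ᵥ A *ᵥ z - A.trace) * (z ⬝ᵥ C *ᵥ z - C.trace) * stdNormalDensity z =
      2 * (A * C).trace := by
  have hq : ∀ (A : Matrix (Fin n) (Fin n) ℝ) (z : Fin n → ℝ), z ⬝ᵥ A *ᵥ z - A.trace =
      ∑ i, ∑ j, A i j * (z i * z j - if i = j then 1 else 0) := by
    intro A z
    simp only [mul_sub, Finset.sum_sub_distrib, mul_ite, mul_one, mul_zero, Finset.sum_ite_eq,
      Finset.mem_univ, if_true]
    congr 1
    simp only [dotProduct, Matrix.mulVec, Finset.mul_sum]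
    exact Finset.sum_congr rfl fun i _ => Finset.sum_congr rfl fun j _ => by ring
  have e : (fun z : Fin n → ℝ =>
      (z ⬝ᵥ A *ᵥ z - A.trace) * (z ⬝ᵥ C *ᵥ z - C.trace) * stdNormalDensity z) =
      fun z => ∑ i, ∑ j, ∑ k, ∑ l, (A i j * C k l) * ((z i * z j - if i = j then 1 else 0) *
        (z k * z l - if k = l then 1 else 0) * stdNormalDensity z) := by
    funext z
    rw [hq, hq]
    simp only [Finset.sum_mul]
    simp only [Finset.mul_sum, Finset.sum_mul]
    exact Finset.sum_congr rfl fun i _ => Finset.sum_congr rfl fun j _ =>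
      Finset.sum_congr rfl fun k _ => Finset.sum_congr rfl fun l _ => by ring
  have hint := fun i j k l => ((integral_wick (n := n) i j k l).1).const_mul (A i j * C k l)
  rw [e, integral_finsetSum _ fun i _ => integrable_finsetSum _ fun j _ =>
    integrable_finsetSum _ fun k _ => integrable_finsetSum _ fun l _ => hint i j k l]
  have : ∀ i, ∫ z : Fin n → ℝ, ∑ j, ∑ k, ∑ l, (A i j * C k l) *
      ((z i * z j - if i = j then 1 else 0) *
        (z k * z l - if k = l then 1 else 0) * stdNormalDensity z) = ∑ j, 2 * (A i j * C j i) := by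
    intro i
    rw [integral_finsetSum _ fun j _ =>
      integrable_finsetSum _ fun k _ => integrable_finsetSum _ fun l _ => hint i j k l]
    refine Finset.sum_congr rfl fun j _ => ?_
    rw [integral_finsetSum _ fun k _ => integrable_finsetSum _ fun l _ => hint i j k l]
    have : ∀ k, ∫ z : Fin n → ℝ, ∑ l, (A i j * C k l) *
        ((z i * z j - if i = j then 1 else 0) *
          (z k * z l - if k = l then 1 else 0) * stdNormalDensity z) =
        ∑ l, (A i j * C k l) * ((if i = k then 1 else 0) * (if j = l then 1 else 0)
          + (if i = l then 1 else 0) * (if j = k then 1 else 0)) := by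
      intro k
      rw [integral_finsetSum _ fun l _ => hint i j k l]
      refine Finset.sum_congr rfl fun l _ => ?_
      rw [integral_const_mul, (integral_wick i j k l).2]
    simp only [this, mul_add, Finset.sum_add_distrib]
    have hCij : C i j = C j i := congrFun (congrFun hC j) i
    simp [hCij]
    ring
  simp only [this]
  simp only [Matrix.trace, Matrix.diag, Matrix.mul_apply, Finset.mul_sum]

end GaussianMoments

section FisherMetric

attribute [local instance] Matrix.linftyOpNormedRing Matrix.linftyOpNormedAlgebra

open SymMatrix OpenSubset

variable {n : ℕ}

namespace SymMatrix

lemma hasDerivAt_det_add_smul {S : SymMatrix n} (hS : (mat S).PosDef) (X : SymMatrix n) :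
    HasDerivAt (fun t : ℝ => (mat (S + t • X)).det)
      ((mat S).det * ((mat S)⁻¹ * mat X).trace) 0 := by
  have hs := isUnit_det hS
  set M := (mat S)⁻¹ * mat X with hM
  set P := (Matrix.det (1 + (Polynomial.X : Polynomial ℝ) •
    M.map Polynomial.C)).divX.divX with hP
  have e : (fun t : ℝ => (mat (S + t • X)).det) =
      fun t => (mat S).det * (1 + M.trace * t + P.eval t * t ^ 2) := by
    funext t
    rw [← Matrix.det_one_add_smul, ← Matrix.det_mul, map_add, map_smul, mul_add, mul_one,
      Matrix.mul_smul, hM, ← Matrix.mul_assoc, Matrix.mul_nonsing_inv _ hs, Matrix.one_mul]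
  rw [e]
  have h1 : HasDerivAt (fun t : ℝ => 1 + M.trace * t + P.eval t * t ^ 2) M.trace 0 := by
    have := (((hasDerivAt_id (0 : ℝ)).const_mul M.trace).const_add 1).add
      ((P.hasDerivAt 0).mul ((hasDerivAt_id (0 : ℝ)).pow 2))
    refine (this.congr_deriv ?_)
    simp
  exact h1.const_mul _

lemma differentiableAt_det (S : SymMatrix n) :
    DifferentiableAt ℝ (fun T : SymMatrix n => (mat T).det) S := by
  have hent : ∀ i j, DifferentiableAt ℝ (fun T : SymMatrix n => mat T i j) S := fun i j =>
    (LinearMap.toContinuousLinearMap ((Matrix.entryLinearMap ℝ ℝ i j) ∘ₗ mat :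
      SymMatrix n →ₗ[ℝ] ℝ)).differentiableAt
  simp only [Matrix.det_apply']
  fun_prop

/-- Jacobi's formula. -/
lemma fderiv_det {S : SymMatrix n} (hS : (mat S).PosDef) (X : SymMatrix n) :
    fderiv ℝ (fun T : SymMatrix n => (mat T).det) S X =
      (mat S).det * ((mat S)⁻¹ * mat X).trace := by
  have hl : HasDerivAt (fun t : ℝ => S + t • X) X 0 := by
    simpa using ((hasDerivAt_id (0 : ℝ)).smul_const X).const_add S
  have h1 := (differentiableAt_det S).hasFDerivAt.comp_hasDerivAt_of_eq (0 : ℝ) hl (by simp)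
  exact h1.unique (hasDerivAt_det_add_smul hS X)

/-- Evaluation of the quadratic form of a matrix at a vector. -/
noncomputable def quadEval (x : Fin n → ℝ) : Matrix (Fin n) (Fin n) ℝ →L[ℝ] ℝ :=
  LinearMap.toContinuousLinearMap
    { toFun := fun A => x ⬝ᵥ (A *ᵥ x)
      map_add' := fun A B => by rw [Matrix.add_mulVec, dotProduct_add]
      map_smul' := fun c A => by rw [Matrix.smul_mulVec, dotProduct_smul]; rfl }

lemma quadEval_apply (x : Fin n → ℝ) (A : Matrix (Fin n) (Fin n) ℝ) :
    quadEval x A = x ⬝ᵥ (A *ᵥ x) := rfl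

lemma hasFDerivAt_logDensity {S : SymMatrix n} (hS : (mat S).PosDef) (x : Fin n → ℝ) :
    ∃ L : SymMatrix n →L[ℝ] ℝ, HasFDerivAt (fun T : SymMatrix n =>
      Real.log (1 / √((2 * Real.pi) ^ n * (mat T).det) *
        Real.exp (-(1 / 2) * (x ⬝ᵥ ((mat T)⁻¹ *ᵥ x))))) L S ∧
      ∀ X, L X = (1 / 2) * (x ⬝ᵥ (((mat S)⁻¹ * mat X * (mat S)⁻¹) *ᵥ x)
        - ((mat S)⁻¹ * mat X).trace) := by
  have hdet := (differentiableAt_det S).hasFDerivAt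
  have hpos := hS.det_pos
  have h1 := (hdet.log hpos.ne').const_mul (1 / 2 : ℝ)
  have h2 := ((quadEval x).hasFDerivAt.comp S (hasFDerivAt_inv hS)).const_mul (1 / 2 : ℝ)
  have h3 := (h1.add h2).const_sub (-(1 / 2) * Real.log ((2 * Real.pi) ^ n))
  refine ⟨_, h3.congr_of_eventuallyEq ?_, fun X => ?_⟩
  · filter_upwards [isOpen_posDef.mem_nhds hS] with T hT
    have hT' : 0 < (mat T).det := Matrix.PosDef.det_pos hT
    have hpi : 0 < (2 * Real.pi) ^ n := by positivity
    rw [Real.log_mul (by positivity) (Real.exp_pos _).ne', Real.log_exp, one_div, Real.log_inv,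
      Real.log_sqrt (by positivity), Real.log_mul hpi.ne' hT'.ne']
    change _ = -(1 / 2) * Real.log ((2 * Real.pi) ^ n) -
      (1 / 2 * Real.log (mat T).det + 1 / 2 * (x ⬝ᵥ ((mat T)⁻¹ *ᵥ x)))
    ring
  · change -((1 / 2 : ℝ) * ((mat S).det⁻¹ * fderiv ℝ (fun T : SymMatrix n => (mat T).det) S X) +
      (1 / 2 : ℝ) * quadEval x (-((mat S)⁻¹ * mat X * (mat S)⁻¹))) = _
    rw [fderiv_det hS, map_neg, quadEval_apply]
    field_simp
    ring

end SymMatrix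

lemma gaussScore_eq (S : centeredGaussians n) (X : SymMatrix n) (x : Fin n → ℝ) :
    gaussScore S X x = (1 / 2) * (x ⬝ᵥ (((mat S.1)⁻¹ * mat X * (mat S.1)⁻¹) *ᵥ x)
      - ((mat S.1)⁻¹ * mat X).trace) := by
  obtain ⟨L, hL, hLX⟩ := hasFDerivAt_logDensity S.2 x
  rw [← hLX]
  exact mfderiv_comp_val hL X

lemma stdNormalDensity_eq (z : Fin n → ℝ) :
    stdNormalDensity z = (√(2 * Real.pi) ^ n)⁻¹ * Real.exp (-(1 / 2) * (z ⬝ᵥ z)) := by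
  simp only [stdNormalDensity, normalDensity, Finset.prod_mul_distrib, Finset.prod_const,
    Finset.card_univ, Fintype.card_fin, inv_pow, ← Real.exp_sum, ← Finset.mul_sum, dotProduct, sq]

lemma integral_comp_mulVec {B : Matrix (Fin n) (Fin n) ℝ} (hB : IsUnit B)
    (f : (Fin n → ℝ) → ℝ) : ∫ x, f x = |B.det| * ∫ z, f (B *ᵥ z) := by
  have hd : B.det ≠ 0 := ((Matrix.isUnit_iff_isUnit_det B).1 hB).ne_zero
  have h := Real.map_matrix_volume_pi_eq_smul_volume_pi hd
  let e : (Fin n → ℝ) ≃ₗ[ℝ] (Fin n → ℝ) :=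
    Matrix.toLin'OfInv (Matrix.nonsing_inv_mul B hd.isUnit) (Matrix.mul_nonsing_inv B hd.isUnit)
  have he : MeasurableEmbedding (Matrix.toLin' B) := by
    have h1 : ⇑e.toContinuousLinearEquiv.toHomeomorph = Matrix.toLin' B := by
      ext; simp [e]
    rw [← h1]
    exact e.toContinuousLinearEquiv.toHomeomorph.measurableEmbedding
  have h2 := he.integral_map (μ := volume) f
  rw [h, integral_smul_measure, ENNReal.toReal_ofReal (abs_nonneg _), smul_eq_mul] at h2
  simp only [Matrix.toLin'_apply] at h2
  rw [← h2, abs_inv, ← mul_assoc, mul_inv_cancel₀ (abs_pos.2 hd).ne', one_mul]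

lemma gaussDensity_mulVec {S : centeredGaussians n} {B : Matrix (Fin n) (Fin n) ℝ}
    (hB : IsUnit B) (hS : mat S.1 = B * Bᵀ) (z : Fin n → ℝ) :
    |B.det| * gaussDensity S (B *ᵥ z) = stdNormalDensity z := by
  have hd : B.det ≠ 0 := ((Matrix.isUnit_iff_isUnit_det B).1 hB).ne_zero
  have hdt : IsUnit Bᵀ.det := by rw [Matrix.det_transpose]; exact hd.isUnit
  have hq : (B *ᵥ z) ⬝ᵥ ((mat S.1)⁻¹ *ᵥ (B *ᵥ z)) = z ⬝ᵥ z := by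
    rw [hS, Matrix.mul_inv_rev, Matrix.mulVec_mulVec, Matrix.mul_assoc,
      Matrix.nonsing_inv_mul _ hd.isUnit, Matrix.mul_one, ← Matrix.vecMul_transpose,
      ← Matrix.dotProduct_mulVec, Matrix.mulVec_mulVec, Matrix.mul_nonsing_inv _ hdt,
      Matrix.one_mulVec]
  have hdet : √((2 * Real.pi) ^ n * (mat S.1).det) = √(2 * Real.pi) ^ n * |B.det| := by
    rw [hS, Matrix.det_mul, Matrix.det_transpose, Real.sqrt_mul (by positivity),
      Real.sqrt_mul_self_eq_abs, Real.sqrt_eq_rpow, Real.sqrt_eq_rpow, ← Real.rpow_natCast,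
      ← Real.rpow_natCast, ← Real.rpow_mul (by positivity), ← Real.rpow_mul (by positivity),
      mul_comm (n : ℝ)]
  rw [gaussDensity, hq, hdet, stdNormalDensity_eq]
  have : |B.det| ≠ 0 := (abs_pos.2 hd).ne'
  field_simp

/-- The Fisher metric of the centered normal distributions is `tr(S⁻¹ X S⁻¹ Y) / 2`. -/
theorem fisherMetric_eq (S : centeredGaussians n) (X Y : SymMatrix n) :
    fisherMetric S X Y = traceForm S.1 X Y := by
  obtain ⟨B, hB, hS⟩ := Matrix.PosDef.exists_isUnit_mul_transpose S.2
  have hd : IsUnit B.det := (Matrix.isUnit_iff_isUnit_det B).1 hB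
  have hdt : IsUnit Bᵀ.det := by rwa [Matrix.det_transpose]
  let W : SymMatrix n → Matrix (Fin n) (Fin n) ℝ := fun V => B⁻¹ * mat V * Bᵀ⁻¹
  have hinv : (mat S.1)⁻¹ = Bᵀ⁻¹ * B⁻¹ := by
    rw [show mat S.1 = B * Bᵀ from hS, Matrix.mul_inv_rev]
  have htr : ∀ V : SymMatrix n, ((mat S.1)⁻¹ * mat V).trace = (W V).trace := fun V => by
    rw [hinv, Matrix.mul_assoc, Matrix.trace_mul_comm]
  have hquad : ∀ (V : SymMatrix n) (z : Fin n → ℝ),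
      (B *ᵥ z) ⬝ᵥ (((mat S.1)⁻¹ * mat V * (mat S.1)⁻¹) *ᵥ (B *ᵥ z)) = z ⬝ᵥ (W V *ᵥ z) := by
    intro V z
    have hl : ∀ w, (B *ᵥ z) ⬝ᵥ w = z ⬝ᵥ (Bᵀ *ᵥ w) := fun w => by
      rw [Matrix.dotProduct_mulVec, Matrix.vecMul_transpose]
    rw [hl, Matrix.mulVec_mulVec, Matrix.mulVec_mulVec]
    congr 2
    rw [hinv]
    simp only [Matrix.mul_assoc, Matrix.nonsing_inv_mul _ hd, Matrix.mul_one]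
    rw [← Matrix.mul_assoc, Matrix.mul_nonsing_inv _ hdt, Matrix.one_mul, ← Matrix.mul_assoc]
  have hWt : (W Y)ᵀ = W Y := by
    simp only [W, Matrix.transpose_mul, Matrix.transpose_nonsing_inv, Matrix.transpose_transpose,
      mat_transpose, Matrix.mul_assoc]
  have hWW : (W X * W Y).trace = ((mat S.1)⁻¹ * mat X * (mat S.1)⁻¹ * mat Y).trace := by
    rw [hinv]
    simp only [W, ← Matrix.mul_assoc]
    rw [Matrix.trace_mul_comm]
    simp only [← Matrix.mul_assoc]
  have hF : fisherMetric S X Y =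
    ∫ x : Fin n → ℝ, gaussScore S X x * gaussScore S Y x * gaussDensity S x := rfl
  rw [traceForm_apply, ← hWW, hF, integral_comp_mulVec hB, ← integral_const_mul]
  have e : ∀ z : Fin n → ℝ, |B.det| * (gaussScore S X (B *ᵥ z) * gaussScore S Y (B *ᵥ z) *
      gaussDensity S (B *ᵥ z)) = (1 / 4 : ℝ) * ((z ⬝ᵥ W X *ᵥ z - (W X).trace) *
        (z ⬝ᵥ W Y *ᵥ z - (W Y).trace) * stdNormalDensity z) := by
    intro z
    rw [gaussScore_eq, gaussScore_eq, hquad, hquad, htr, htr, ← gaussDensity_mulVec hB hS z]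
    ring
  simp only [e]
  rw [integral_const_mul, integral_quadratic_mul_quadratic _ _ hWt]
  ring

end FisherMetric

lemma invariantStat_traceMetric (n : ℕ) :
    invariantStat (traceMetric n) (RiemannianIsom (traceMetric n)) = {traceConnection n} := by
  refine Set.eq_singleton_iff_unique_mem.2 ⟨⟨traceConnection_isLeviCivita.isStatistical, fun h =>
    traceConnection_isLeviCivita.isAffineMap SmoothVectorField.exists_apply_eq h.2⟩,
    fun D hD => eq_traceConnection_of_invariant D fun f hf => hD.2 ⟨f, hf⟩⟩

theorem mainTheorem2 (n : ℕ) (hn : 1 ≤ n) :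
    ∃ g : SmoothRiemannianMetric (gaussModel n) (centeredGaussians n),
      (∀ (S : centeredGaussians n) (X Y : TangentSpace (gaussModel n) S),
        g.inner S X Y = fisherMetric S X Y) ∧
      ∃ D : AffineConnection (gaussModel n) (centeredGaussians n),
        D.IsLeviCivita g ∧
        (∀ D' : AffineConnection (gaussModel n) (centeredGaussians n),
          D'.IsLeviCivita g → D' = D) ∧
        invariantStat g (RiemannianIsom g) = {D} ∧
        (2 ≤ n → invariantStatDF g (RiemannianIsom g) = ∅) ∧
        (n = 1 → invariantStatDF g (RiemannianIsom g) = {D}) ∧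
        (∃ hD : D ∈ invariantStat g (RiemannianIsom g),
          (Set.univ : Set (HSModuli g (RiemannianIsom g)
            (invariantStat g (RiemannianIsom g)))) =
              {HSModuli.mk g (RiemannianIsom g) D hD}) ∧
        (2 ≤ n → (Set.univ : Set (HSModuli g (RiemannianIsom g)
            (invariantStatDF g (RiemannianIsom g)))) = ∅) ∧
        (n = 1 → ∃ hD : D ∈ invariantStatDF g (RiemannianIsom g),
          (Set.univ : Set (HSModuli g (RiemannianIsom g)
            (invariantStatDF g (RiemannianIsom g)))) =
              {HSModuli.mk g (RiemannianIsom g) D hD}) := by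
  have hstat := invariantStat_traceMetric n
  have hmem : traceConnection n ∈
      invariantStat (traceMetric n) (RiemannianIsom (traceMetric n)) := by
    rw [hstat]; rfl
  have hsub : ∀ {D}, D ∈ invariantStatDF (traceMetric n) (RiemannianIsom (traceMetric n)) →
      D = traceConnection n := fun hD => by
    have h := hD.1
    rwa [hstat] at h
  have hempty : 2 ≤ n → invariantStatDF (traceMetric n) (RiemannianIsom (traceMetric n)) = ∅ :=
    fun h2 => Set.eq_empty_of_forall_notMem fun D hD =>
      traceConnection_not_isFlat h2 (hsub hD ▸ hD.2)
  have hmemDF : n = 1 → traceConnection n ∈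
      invariantStatDF (traceMetric n) (RiemannianIsom (traceMetric n)) := by
    rintro rfl
    exact ⟨hmem, traceConnection_isFlat_one⟩
  refine ⟨traceMetric n, fun S X Y => (fisherMetric_eq S X Y).symm, traceConnection n,
    traceConnection_isLeviCivita,
    fun D' hD' => traceConnection_isLeviCivita.unique SmoothVectorField.exists_apply_eq hD',
    hstat, hempty, fun h1 => ?_, ⟨hmem, ?_⟩, fun h2 => ?_, fun h1 => ⟨hmemDF h1, ?_⟩⟩
  · exact Set.eq_singleton_iff_unique_mem.2 ⟨hmemDF h1, fun D hD => hsub hD⟩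
  · refine Set.eq_singleton_iff_unique_mem.2 ⟨Set.mem_univ _, fun c _ => ?_⟩
    induction c using Quotient.inductionOn with
    | h x =>
      obtain ⟨D, hD⟩ := x
      have h := hD
      rw [hstat] at h
      obtain rfl : D = traceConnection n := h
      rfl
  · refine Set.eq_empty_of_forall_notMem fun c _ => ?_
    induction c using Quotient.inductionOn with
    | h x =>
      exact Set.eq_empty_iff_forall_notMem.1 (hempty h2) x.1 x.2
  · refine Set.eq_singleton_iff_unique_mem.2 ⟨Set.mem_univ _, fun c _ => ?_⟩
    induction c using Quotient.inductionOn with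
    | h x =>
      obtain ⟨D, hD⟩ := x
      obtain rfl : D = traceConnection n := hsub hD
      rfl
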